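/- Let $n\ge 1$, let $\Omega\subset\mathbb R^n$ be a bounded open set with Lipschitz boundary, and let $q\ge 1$. Let $\mathrm{BV}(\Omega)$ be the space of all $u\in L^1(\Omega)$ with finite total variation $$\int_\Omega|Du|:=\sup\Big\{\int_\Omega u\,\mathrm{div}\,g\,dx:\ g\in C^1_c(\Omega)^n,\ |g|\le 1\Big\}<\infty .$$ For $u\in \mathrm{BV}(\Omega)$ let $$\mathscr A(u)=\int_\Omega\sqrt{1+|\nabla u|^2}:=\sup\Big\{\int_\Omega \big(g_0+u\,\mathrm{div}\,g\big)\,dx:\ g_0\in C^1_c(\Omega),\ g\in C^1_c(\Omega)^n,\ g_0^2+|g|^2\le 1\Big\},$$ and let the value of $u$ at $x\in\partial\Omega$ be its trace, that is, for $\mathscr H^{n-1}$-almost every $x\in\partial\Omega$, the number $u(x)$ with $\lim_{r\downarrow0}r^{-n}\int_{B_r(x)\cap\Omega}|u(y)-u(x)|\,dy=0$. Let $G_\pm:\Omega\times\mathbb R\to\mathbb R$ be such that $x\mapsto G_\pm(x,v(x))$ is measurable for every $v\in L^q(\Omega)\cap\mathrm{BV}(\Omega)$ (for example, Carathéodory functions),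 and suppose that $|G_\pm(x,s)|\le C_1(x)|s|^q+C_2(x)$ for almost every $x\in\Omega$ and all $s\in\mathbb R$, where $C_1\in L^\infty(\Omega)$ and $C_2\in L^1(\Omega)$. For $v\in L^q(\Omega)\cap \mathrm{BV}(\Omega)$ put $$\mathscr F_\pm(v)=\mathscr A(v)+\int_{\partial\Omega}|v|\,d\mathscr H^{n-1}+\int_\Omega G_\pm(x,v(x))\,dx,\qquad \Delta(v)=\int_\Omega \big(G_+(x,v(x))-G_-(x,v(x))\big)\,dx .$$ Let $K_+,K_-\subset L^q(\Omega)\cap \mathrm{BV}(\Omega)$, and let $u_+\in K_+$ and $u_-\in K_-$ be global minimizers of $\mathscr F_+$ on $K_+$ and of $\mathscr F_-$ on $K_-$, respectively. If $$\min(u_+,u_-)\in K_-\quad\text{and}\quad \max(u_+,u_-)\in K_+,$$ then $$\Delta(\max(u_+,u_-))-\Delta(u_+)\ge 0 .$$ -/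

import Mathlib

open MeasureTheory Set Filter Topology
open scoped ENNReal NNReal

namespace BVArea

noncomputable section

/-- The divergence `∑ i, ∂ᵢ gᵢ` of a vector field on `ℝⁿ`. -/
def div {n : ℕ} (g : EuclideanSpace ℝ (Fin n) → EuclideanSpace ℝ (Fin n))
    (x : EuclideanSpace ℝ (Fin n)) : ℝ :=
  ∑ i, (fderiv ℝ g x (EuclideanSpace.single i 1)) i

/-- `C¹` maps with compact support contained in `Ω`, extended by zero to the whole space. -/
def IsTest {n : ℕ} {F : Type*} [NormedAddCommGroup F] [NormedSpace ℝ F]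
    (Ω : Set (EuclideanSpace ℝ (Fin n))) (g : EuclideanSpace ℝ (Fin n) → F) : Prop :=
  ContDiff ℝ 1 g ∧ HasCompactSupport g ∧ tsupport g ⊆ Ω

/-- The total variation `∫_Ω |Du|`, the supremum of `∫_Ω u div g` over `g ∈ C¹_c(Ω)ⁿ` with
`|g| ≤ 1`. (Since `g = 0` is allowed, cutting off negative values by `ENNReal.ofReal` does not
change the supremum.) -/
def totalVariation {n : ℕ} (Ω : Set (EuclideanSpace ℝ (Fin n)))
    (u : EuclideanSpace ℝ (Fin n) → ℝ) : ℝ≥0∞ :=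
  ⨆ (g : EuclideanSpace ℝ (Fin n) → EuclideanSpace ℝ (Fin n))
    (_ : IsTest Ω g) (_ : ∀ x, ‖g x‖ ≤ 1),
    ENNReal.ofReal (∫ x in Ω, u x * div g x)

/-- `u ∈ BV(Ω)`: `u ∈ L¹(Ω)` with finite total variation over `Ω`. -/
def MemBV {n : ℕ} (Ω : Set (EuclideanSpace ℝ (Fin n)))
    (u : EuclideanSpace ℝ (Fin n) → ℝ) : Prop :=
  IntegrableOn u Ω ∧ totalVariation Ω u < ∞

/-- The space `L^q ∩ BV(Ω)`; only the values of the functions on `Ω` matter. -/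
def LqBV {n : ℕ} (q : ℝ) (Ω : Set (EuclideanSpace ℝ (Fin n))) :
    Set (EuclideanSpace ℝ (Fin n) → ℝ) :=
  {u | MemLp u (ENNReal.ofReal q) (volume.restrict Ω) ∧ MemBV Ω u}

/-- The area `𝒜(u) = ∫_Ω √(1 + |∇u|²)` of the graph of `u`, the supremum of
`∫_Ω (g₀ + u div g)` over `g₀ ∈ C¹_c(Ω)`, `g ∈ C¹_c(Ω)ⁿ` with `g₀² + |g|² ≤ 1`. -/
def area {n : ℕ} (Ω : Set (EuclideanSpace ℝ (Fin n)))
    (u : EuclideanSpace ℝ (Fin n) → ℝ) : ℝ≥0∞ :=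
  ⨆ (g₀ : EuclideanSpace ℝ (Fin n) → ℝ)
    (g : EuclideanSpace ℝ (Fin n) → EuclideanSpace ℝ (Fin n))
    (_ : IsTest Ω g₀) (_ : IsTest Ω g) (_ : ∀ x, g₀ x ^ 2 + ‖g x‖ ^ 2 ≤ 1),
    ENNReal.ofReal (∫ x in Ω, (g₀ x + u x * div g x))

/-- `Ω` has Lipschitz boundary: near each boundary point there is a direction `e` such that `Ω` is
the part lying above the graph of a Lipschitz function of the component orthogonal to `e`. -/
def HasLipschitzBoundary {n : ℕ} (Ω : Set (EuclideanSpace ℝ (Fin n))) : Prop :=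
  ∀ x ∈ frontier Ω, ∃ e : EuclideanSpace ℝ (Fin n), ‖e‖ = 1 ∧
    ∃ (K : ℝ≥0) (γ : EuclideanSpace ℝ (Fin n) → ℝ), LipschitzWith K γ ∧
      ∀ᶠ y in 𝓝 x, (y ∈ Ω ↔ γ (y - inner ℝ e y • e) < inner ℝ e y)

/-- The number `t` is the trace of `u` at the boundary point `x` of `Ω`:
`r⁻ⁿ ∫_{B_r(x) ∩ Ω} |u(y) - t| dy → 0` as `r ↓ 0`. -/
def HasTraceAt {n : ℕ} (Ω : Set (EuclideanSpace ℝ (Fin n)))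
    (u : EuclideanSpace ℝ (Fin n) → ℝ) (x : EuclideanSpace ℝ (Fin n)) (t : ℝ) : Prop :=
  Tendsto (fun r : ℝ => (r ^ n)⁻¹ * ∫ y in Metric.ball x r ∩ Ω, |u y - t|) (𝓝[>] 0) (𝓝 0)

open Classical in
/-- The boundary trace of `u`. For `u ∈ BV(Ω)` and `∂Ω` Lipschitz, the trace exists (and is unique)
at almost every boundary point for the surface measure; at the others the value is set to `0`. -/
def trace {n : ℕ} (Ω : Set (EuclideanSpace ℝ (Fin n)))
    (u : EuclideanSpace ℝ (Fin n) → ℝ) (x : EuclideanSpace ℝ (Fin n)) : ℝ :=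
  if h : ∃ t, HasTraceAt Ω u x t then h.choose else 0

/-- The functional `𝒜(v) + ∫_{∂Ω} |v| dℋⁿ⁻¹ + ∫_Ω G(x, v) dx`, where `v` on `∂Ω` is the trace and
`μHE[n - 1]` is the normalized `(n - 1)`-dimensional Hausdorff measure (used for `n ≥ 1`). -/
def energy {n : ℕ} (Ω : Set (EuclideanSpace ℝ (Fin n)))
    (G : EuclideanSpace ℝ (Fin n) → ℝ → ℝ) (v : EuclideanSpace ℝ (Fin n) → ℝ) : ℝ :=
  (area Ω v).toReal + (∫ x in frontier Ω, |trace Ω v x| ∂μHE[n - 1]) + ∫ x in Ω, G x (v x)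

/-- `Δ(v) = ∫_Ω (G₊(x, v) - G₋(x, v)) dx`. -/
def energyGap {n : ℕ} (Ω : Set (EuclideanSpace ℝ (Fin n)))
    (Gp Gm : EuclideanSpace ℝ (Fin n) → ℝ → ℝ) (v : EuclideanSpace ℝ (Fin n) → ℝ) : ℝ :=
  ∫ x in Ω, (Gp x (v x) - Gm x (v x))

/-- `u` is a global minimizer of `J` on the set `K` (and belongs to `K`). -/
def IsMinimizer {X : Type*} (J : X → ℝ) (K : Set X) (u : X) : Prop :=
  u ∈ K ∧ ∀ v ∈ K, J u ≤ J v

end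

end BVArea

/-! Minimality is tested with the competitors exchanged: `max(u₊, u₋)` against `u₊` in `ℱ₊`, and
`min(u₊, u₋)` against `u₋` in `ℱ₋`. Add the two inequalities. The terms in `G₋` satisfy `∫ G₋(max) +
∫ G₋(min) = ∫ G₋(u₊) + ∫ G₋(u₋)`, since at each point max and min are the two values in some order.
The boundary terms satisfy the same identity. The area is submodular, `𝒜(max) + 𝒜(min) ≤ 𝒜(u₊) +
𝒜(u₋)`. After cancellation exactly the claim is left.

Submodularity (`area_max_add_area_min_le`) is proved by duality. For smooth `U`, `V` and a smoothed
maximum, the gradients of maximum and minimum are `s∇U + (1-s)∇V` and `(1-s)∇U + s∇V` with `0 ≤ s ≤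
1`. Pairing them with `g` and `h` is therefore the same as pairing `∇U` with `s g + (1-s) h` and
`∇V` with `s h + (1-s) g`; the scalar components `g₀`, `h₀` are mixed in the same way. The unit ball
is convex, so the new pairs are admissible for `𝒜(U)` and `𝒜(V)`. General `u`, `v` are mollified:
the mollifier moves onto the test pair, which stays admissible by Jensen, and the error vanishes by
`L¹` convergence.

The boundary identity needs the trace theorem (`ae_exists_hasTraceAt_and_integrableOn_trace`):
existence almost everywhere, so that the traces of max and min are the max and min of the traces,
and integrability, so that the boundary integrals add. In a chart above a Lipschitz graph, total
variation bounds the vertical derivatives of the mollifications in `L¹`, uniformly up to the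
boundary. Hence on almost every vertical line the oscillations over dyadic intervals are summable,
and the averages over these intervals converge to a limit `τ`. At Lebesgue points of `τ` and of the
oscillation tails this limit is the trace in the sense of means over balls. Finally the surface
measure is dominated by the image of Lebesgue measure under the Lipschitz graph map. -/

namespace BVArea

/-! ### Mollification: duality with test fields, and `L¹` convergence -/

section Mollification

open scoped Convolution Pointwise

variable {n : ℕ} {F : Type*} [NormedAddCommGroup F] [NormedSpace ℝ F]

local notation "𝔼" => EuclideanSpace ℝ (Fin n)

/-- Convolution with the normalized bump function `φ`. -/
noncomputable def mollify (φ : ContDiffBump (0 : EuclideanSpace ℝ (Fin n)))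
    (f : EuclideanSpace ℝ (Fin n) → F) : EuclideanSpace ℝ (Fin n) → F :=
  φ.normed volume ⋆[ContinuousLinearMap.lsmul ℝ ℝ, volume] f

variable (φ : ContDiffBump (0 : EuclideanSpace ℝ (Fin n)))

lemma mollify_apply (f : 𝔼 → F) (x : 𝔼) :
    mollify φ f x = ∫ t, φ.normed volume t • f (x - t) := rfl

lemma contDiff_mollify [CompleteSpace F] {f : 𝔼 → F} (hf : LocallyIntegrable f) {m : ℕ∞} :
    ContDiff ℝ m (mollify φ f) :=
  φ.hasCompactSupport_normed.contDiff_convolution_left _ φ.contDiff_normed hf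

lemma integrable_mollify {f : 𝔼 → F} (hf : Integrable f) : Integrable (mollify φ f) :=
  φ.integrable_normed.integrable_convolution _ hf

lemma integral_mollify [CompleteSpace F] {f : 𝔼 → F} (hf : Integrable f) :
    ∫ x, mollify φ f x = ∫ x, f x := by
  unfold mollify
  rw [integral_convolution _ φ.integrable_normed hf, φ.integral_normed]
  simp

lemma norm_mollify_le [CompleteSpace F] {f : 𝔼 → F} (hf : AEStronglyMeasurable f volume) {C : ℝ}
    (hC : ∀ x, ‖f x‖ ≤ C) (x : 𝔼) : ‖mollify φ f x‖ ≤ C := by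
  have := dist_convolution_le (μ := volume) (f := φ.normed volume) (g := f) (x₀ := x)
    (R := φ.rOut) (z₀ := 0) ((norm_nonneg _).trans (hC 0)) φ.support_normed_eq.subset
    φ.nonneg_normed φ.integral_normed hf (fun y _ => by simpa using hC y)
  simpa [mollify] using this

lemma convolutionExists_normed {f : 𝔼 → F} (hf : Continuous f) (hc : HasCompactSupport f) :
    ConvolutionExists (φ.normed volume) f (ContinuousLinearMap.lsmul ℝ ℝ) volume :=
  hc.convolutionExists_right _ φ.integrable_normed.locallyIntegrable hf

lemma clm_mollify [CompleteSpace F] {F' : Type*} [NormedAddCommGroup F'] [NormedSpace ℝ F']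
    [CompleteSpace F'] (L : F →L[ℝ] F') {f : 𝔼 → F} (hf : Continuous f)
    (hc : HasCompactSupport f) (x : 𝔼) :
    L (mollify φ f x) = mollify φ (fun y => L (f y)) x := by
  rw [mollify_apply, mollify_apply, ← L.integral_comp_comm]
  · simp
  · exact convolutionExists_normed φ hf hc x

lemma fderiv_mollify [CompleteSpace F] {f : 𝔼 → F} (hf : ContDiff ℝ 1 f)
    (hc : HasCompactSupport f) (x v : 𝔼) :
    fderiv ℝ (mollify φ f) x v = mollify φ (fun y => fderiv ℝ f y v) x := by
  have h := hc.hasFDerivAt_convolution_right (μ := volume) (ContinuousLinearMap.lsmul ℝ ℝ)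
    (φ.integrable_normed (μ := volume)).locallyIntegrable hf x
  rw [mollify, h.fderiv, convolution_precompR_apply _ φ.integrable_normed.locallyIntegrable
    (hc.fderiv ℝ) (hf.continuous_fderiv one_ne_zero)]
  rfl

lemma continuous_div {g : 𝔼 → 𝔼} (hg : ContDiff ℝ 1 g) : Continuous (div g) := by
  unfold div
  have := hg.continuous_fderiv one_ne_zero
  fun_prop

lemma tsupport_div_subset (g : 𝔼 → 𝔼) : tsupport (div g) ⊆ tsupport g := by
  refine (closure_mono fun x hx => ?_).trans (tsupport_fderiv_subset ℝ (f := g))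
  contrapose! hx
  simp only [Function.mem_support, not_not] at hx ⊢
  simp [div, hx]

lemma hasCompactSupport_div {g : 𝔼 → 𝔼} (hg : HasCompactSupport g) : HasCompactSupport (div g) :=
  hg.of_isClosed_subset (isClosed_tsupport _) (tsupport_div_subset g)

lemma div_mollify {g : 𝔼 → 𝔼} (hg : ContDiff ℝ 1 g) (hc : HasCompactSupport g) (x : 𝔼) :
    div (mollify φ g) x = mollify φ (div g) x := by
  have hcont := hg.continuous_fderiv one_ne_zero
  have key : ∀ i : Fin n, (fderiv ℝ (mollify φ g) x (EuclideanSpace.single i 1)) i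
      = mollify φ (fun y => (fderiv ℝ g y (EuclideanSpace.single i 1)) i) x := by
    intro i
    rw [fderiv_mollify φ hg hc]
    exact clm_mollify φ (EuclideanSpace.proj i : 𝔼 →L[ℝ] ℝ) (by fun_prop)
      (hc.fderiv_apply ℝ _) x
  unfold div
  simp only [key, mollify_apply]
  rw [← integral_finsetSum]
  · simp [Finset.mul_sum]
  · intro i _
    refine convolutionExists_normed φ (f := fun y => (fderiv ℝ g y (EuclideanSpace.single i 1)) i)
      (by fun_prop) ?_ x
    exact (hc.fderiv_apply ℝ (EuclideanSpace.single i 1)).comp_left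
      (g := fun z : 𝔼 => z i) (by simp)

lemma tsupport_mollify_subset {f : 𝔼 → F} (hc : HasCompactSupport f) :
    tsupport (mollify φ f) ⊆ Metric.closedBall 0 φ.rOut + tsupport f := by
  refine closure_minimal ?_ ((isCompact_closedBall _ _).add hc.isCompact).isClosed
  refine (support_convolution_subset _).trans (add_subset_add ?_ subset_closure)
  rw [φ.support_normed_eq]
  exact Metric.ball_subset_closedBall

lemma isTest_mollify [CompleteSpace F] {Ω : Set 𝔼} {f : 𝔼 → F} (hf : ContDiff ℝ 1 f)
    (hc : HasCompactSupport f) (h : Metric.closedBall 0 φ.rOut + tsupport f ⊆ Ω) :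
    IsTest Ω (mollify φ f) := by
  have hs := tsupport_mollify_subset φ hc
  refine ⟨contDiff_mollify φ (hf.continuous.locallyIntegrable), ?_, hs.trans h⟩
  exact ((isCompact_closedBall _ _).add hc.isCompact).of_isClosed_subset (isClosed_tsupport _) hs

/-- Mollification is self-adjoint: Fubini, translation in `x`, and evenness of the bump. -/
lemma integral_mollify_mul {U f : 𝔼 → ℝ} (hU : Integrable U) (hf : Continuous f)
    (hc : HasCompactSupport f) :
    ∫ x, mollify φ U x * f x = ∫ x, U x * mollify φ f x := by
  obtain ⟨C, hC⟩ := hc.exists_bound_of_continuous hf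
  have hint : Integrable (fun p : 𝔼 × 𝔼 => φ.normed volume p.2 * U (p.1 - p.2) * f p.1)
      (volume.prod volume) := by
    have h1 := φ.integrable_normed.convolution_integrand (μ := volume) (ν := volume)
      (ContinuousLinearMap.lsmul ℝ ℝ) hU
    refine Integrable.mul_bdd (c := C) h1 ?_ (Eventually.of_forall fun p => hC _)
    exact (hf.comp continuous_fst).aestronglyMeasurable
  calc ∫ x, mollify φ U x * f x
      = ∫ x, ∫ t, φ.normed volume t * U (x - t) * f x := by
        refine integral_congr_ae (Eventually.of_forall fun x => ?_)
        simp only [mollify_apply, smul_eq_mul]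
        rw [integral_mul_const]
    _ = ∫ t, ∫ x, φ.normed volume t * U (x - t) * f x := integral_integral_swap hint
    _ = ∫ t, ∫ x, φ.normed volume t * U x * f (x + t) := by
        refine integral_congr_ae (Eventually.of_forall fun t => ?_)
        simp only
        rw [← integral_add_right_eq_self _ t]
        simp
    _ = ∫ x, ∫ t, φ.normed volume t * U x * f (x + t) := by
        refine integral_integral_swap ?_
        have h2 := φ.integrable_normed.mul_prod (μ := volume) (ν := volume) hU
        refine Integrable.mul_bdd (c := C) h2 ?_ (Eventually.of_forall fun p => hC _)
        exact (hf.comp (continuous_snd.add continuous_fst)).aestronglyMeasurable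
    _ = ∫ x, U x * mollify φ f x := by
        refine integral_congr_ae (Eventually.of_forall fun x => ?_)
        simp only [mollify_apply, smul_eq_mul]
        rw [← integral_neg_eq_self, ← integral_const_mul]
        refine integral_congr_ae (Eventually.of_forall fun t => ?_)
        simp only [φ.normed_neg, sub_eq_add_neg]
        ring

/-- Self-adjointness combined with `div (mollify φ g) = mollify φ (div g)`. It turns bounds for
pairings with `u` into bounds for its mollification. -/
lemma integral_mollify_indicator_mul_div {Ω : Set 𝔼} (hΩ : MeasurableSet Ω) {u : 𝔼 → ℝ}
    (hu : IntegrableOn u Ω) {g : 𝔼 → 𝔼} (hg : ContDiff ℝ 1 g) (hc : HasCompactSupport g) :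
    ∫ x, mollify φ (Ω.indicator u) x * div g x = ∫ x in Ω, u x * div (mollify φ g) x := by
  rw [integral_mollify_mul φ ((integrable_indicator_iff hΩ).2 hu) (continuous_div hg)
    (hasCompactSupport_div hc), ← integral_indicator hΩ]
  congr 1
  ext x
  by_cases hx : x ∈ Ω <;> simp [hx, div_mollify φ hg hc]

/-- Jensen for the unit ball of `ℝ × ℝⁿ`, by duality: with `(a, b)` the averaged pair, `N = |(a,
b)|²` is the average of `a g₀ + ⟨b, g⟩`. By Cauchy–Schwarz this is at most `√N`, and `N ≤ √N` forces
`N ≤ 1`. -/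
lemma sq_mollify_add_sq_norm_mollify_le {g₀ : 𝔼 → ℝ} {g : 𝔼 → 𝔼} (hg₀ : Continuous g₀)
    (hc₀ : HasCompactSupport g₀) (hg : Continuous g) (hc : HasCompactSupport g)
    (h : ∀ x, g₀ x ^ 2 + ‖g x‖ ^ 2 ≤ 1) (x : 𝔼) :
    mollify φ g₀ x ^ 2 + ‖mollify φ g x‖ ^ 2 ≤ 1 := by
  set a := mollify φ g₀ x
  set b := mollify φ g x
  set N := a ^ 2 + ‖b‖ ^ 2 with hN
  have h1 : N = mollify φ (fun y => a * g₀ y + inner ℝ b (g y)) x := by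
    have e1 := clm_mollify φ (a • ContinuousLinearMap.id ℝ ℝ) hg₀ hc₀ x
    have e2 := clm_mollify φ (innerSL ℝ b) hg hc x
    have : mollify φ (fun y => a * g₀ y + inner ℝ b (g y)) x
        = mollify φ (fun y => a * g₀ y) x + mollify φ (fun y => inner ℝ b (g y)) x := by
      exact (convolutionExists_normed φ (by fun_prop) (hc₀.mul_left) x).distrib_add
        (convolutionExists_normed φ (by fun_prop)
          (hc.comp_left (g := fun z => inner ℝ b z) (by simp)) x)
    rw [this, hN]
    simp only [smul_apply, ContinuousLinearMap.id_apply, smul_eq_mul,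
      innerSL_apply_apply] at e1 e2
    rw [← e1, ← e2, real_inner_self_eq_norm_sq]
    simp only [a]
    ring
  have h2 : N ≤ √N := by
    conv_lhs => rw [h1]
    have hcont : Continuous fun y => a * g₀ y + inner ℝ b (g y) := by fun_prop
    refine (le_abs_self _).trans (norm_mollify_le φ hcont.aestronglyMeasurable (fun y => ?_) x)
    refine Real.abs_le_sqrt ?_
    have hi := abs_real_inner_le_norm b (g y)
    have hi2 : (inner ℝ b (g y)) ≤ ‖b‖ * ‖g y‖ := (le_abs_self _).trans hi
    have hi3 : -(‖b‖ * ‖g y‖) ≤ inner ℝ b (g y) := neg_le_of_abs_le hi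
    have hb := norm_nonneg b
    have hy := norm_nonneg (g y)
    have hy1 := h y
    calc (a * g₀ y + inner ℝ b (g y)) ^ 2 ≤ (|a| * |g₀ y| + ‖b‖ * ‖g y‖) ^ 2 := by
          refine sq_le_sq.2 (le_trans (abs_add_le _ _) ?_)
          rw [abs_of_nonneg (a := |a| * |g₀ y| + ‖b‖ * ‖g y‖) (by positivity), abs_mul]
          gcongr
      _ ≤ (a ^ 2 + ‖b‖ ^ 2) * (g₀ y ^ 2 + ‖g y‖ ^ 2) := by
          rw [← sq_abs a, ← sq_abs (g₀ y)]
          nlinarith [sq_nonneg (|a| * ‖g y‖ - |g₀ y| * ‖b‖)]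
      _ ≤ N := mul_le_of_le_one_right (by positivity) hy1
  have hN0 : 0 ≤ N := by positivity
  have h3 : N ^ 2 ≤ N := by
    calc N ^ 2 ≤ √N ^ 2 := by gcongr
      _ = N := Real.sq_sqrt hN0
  nlinarith

/-- A sequence of bump functions around the origin with shrinking supports. -/
noncomputable def bump (n k : ℕ) : ContDiffBump (0 : EuclideanSpace ℝ (Fin n)) where
  rIn := 1 / (2 * ((k : ℝ) + 1))
  rOut := 1 / ((k : ℝ) + 1)
  rIn_pos := by positivity
  rIn_lt_rOut := by
    apply one_div_lt_one_div_of_lt <;> linarith [(Nat.cast_nonneg k : (0 : ℝ) ≤ k)]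

lemma tendsto_bump_rOut : Tendsto (fun k => (bump n k).rOut) atTop (𝓝 0) :=
  tendsto_one_div_add_atTop_nhds_zero_nat

lemma ae_tendsto_mollify {U : 𝔼 → ℝ} (hU : Integrable U) :
    ∀ᵐ x, Tendsto (fun k => mollify (bump n k) U x) atTop (𝓝 (U x)) := by
  -- `K = 2` is the ratio `rOut / rIn` of the chosen bumps; it has to stay bounded for Lebesgue
  -- differentiation.
  refine ContDiffBump.ae_convolution_tendsto_right_of_locallyIntegrable (K := 2)
    tendsto_bump_rOut (Eventually.of_forall fun k => ?_) hU.locallyIntegrable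
  simp only [bump]
  apply le_of_eq
  field_simp

/-- Scheffé's argument: the mollification keeps the integral, so the `L¹` distance is twice the
integral of `(U - U_k)⁺`. This function lies between `0` and `U` and tends to `0` almost everywhere.
-/
lemma tendsto_integral_abs_mollify_sub_of_nonneg {U : 𝔼 → ℝ} (hU : Integrable U)
    (h0 : ∀ x, 0 ≤ U x) :
    Tendsto (fun k => ∫ x, |mollify (bump n k) U x - U x|) atTop (𝓝 0) := by
  have hm : ∀ k, Integrable (mollify (bump n k) U) := fun k => integrable_mollify _ hU
  have hnn : ∀ k x, 0 ≤ mollify (bump n k) U x := fun k x =>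
    integral_nonneg fun t => mul_nonneg ((bump n k).nonneg_normed t) (h0 _)
  have h1 : ∀ k, ∫ x, |mollify (bump n k) U x - U x|
      = 2 * ∫ x, max (U x - mollify (bump n k) U x) 0 := by
    intro k
    have e : ∀ x, |mollify (bump n k) U x - U x| = 2 * max (U x - mollify (bump n k) U x) 0
        - (U x - mollify (bump n k) U x) := by
      intro x
      rcases le_total (U x - mollify (bump n k) U x) 0 with h | h
      · rw [max_eq_right h, abs_of_nonneg (by linarith)]; ring
      · rw [max_eq_left h, abs_of_nonpos (by linarith)]; ring
    simp_rw [e]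
    have hd : Integrable fun x => U x - mollify (bump n k) U x := hU.sub (hm k)
    rw [integral_sub (hd.pos_part.const_mul 2) hd, integral_const_mul,
      integral_sub hU (hm k), integral_mollify _ hU]
    simp
  simp_rw [h1]
  have : Tendsto (fun k => ∫ x, max (U x - mollify (bump n k) U x) 0) atTop
      (𝓝 (∫ _x : 𝔼, (0 : ℝ))) := by
    refine tendsto_integral_of_dominated_convergence U
      (fun k => (hU.sub (hm k)).pos_part.aestronglyMeasurable) hU
      (fun k => Eventually.of_forall fun x => ?_) ?_
    · rw [Real.norm_of_nonneg (le_max_right _ _)]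
      exact max_le (by linarith [hnn k x]) (h0 x)
    · filter_upwards [ae_tendsto_mollify hU] with x hx
      have := (tendsto_const_nhds (x := U x)).sub hx
      simpa using this.max (tendsto_const_nhds (x := (0 : ℝ)))
  simpa using this.const_mul 2

lemma tendsto_integral_abs_mollify_sub {U : 𝔼 → ℝ} (hU : Integrable U) :
    Tendsto (fun k => ∫ x, |mollify (bump n k) U x - U x|) atTop (𝓝 0) := by
  set P : 𝔼 → ℝ := fun x => max (U x) 0
  set N : 𝔼 → ℝ := fun x => max (-U x) 0
  have hP : Integrable P := hU.pos_part
  have hN : Integrable N := hU.neg_part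
  have hs := (tendsto_integral_abs_mollify_sub_of_nonneg hP fun x => le_max_right _ _).add
    (tendsto_integral_abs_mollify_sub_of_nonneg hN fun x => le_max_right _ _)
  rw [add_zero] at hs
  have hUe : U = fun x => P x - N x := by
    ext x
    exact (max_zero_sub_max_neg_zero_eq_self (U x)).symm
  refine squeeze_zero (fun k => integral_nonneg fun x => abs_nonneg _) (fun k => ?_) hs
  have hd : ∀ f : 𝔼 → ℝ, Integrable f → Integrable fun x => |mollify (bump n k) f x - f x| :=
    fun f hf => ((integrable_mollify _ hf).sub hf).abs
  rw [← integral_add (hd P hP) (hd N hN)]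
  refine integral_mono_ae (hd U hU) ((hd P hP).add (hd N hN)) (Eventually.of_forall fun x => ?_)
  have hsub : mollify (bump n k) U x = mollify (bump n k) P x - mollify (bump n k) N x := by
    have hex : ∀ f : 𝔼 → ℝ, Integrable f →
        Integrable (fun t => (bump n k).normed volume t • f (x - t)) := fun f hf =>
      (bump n k).hasCompactSupport_normed.convolutionExists_left (ContinuousLinearMap.lsmul ℝ ℝ)
        (bump n k).continuous_normed hf.locallyIntegrable x
    rw [mollify_apply, mollify_apply, mollify_apply, ← integral_sub (hex P hP) (hex N hN)]
    refine integral_congr_ae (Eventually.of_forall fun t => ?_)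
    simp only
    rw [← smul_sub, congrFun hUe (x - t)]
  have h3 : U x = P x - N x := congrFun hUe x
  simp only [hsub, h3]
  rw [show mollify (bump n k) P x - mollify (bump n k) N x - (P x - N x)
    = (mollify (bump n k) P x - P x) - (mollify (bump n k) N x - N x) by ring]
  exact abs_sub _ _

lemma eventually_closedBall_bump_add_subset {K Ω : Set 𝔼} (hK : IsCompact K) (hΩ : IsOpen Ω)
    (h : K ⊆ Ω) : ∀ᶠ k in atTop, Metric.closedBall 0 (bump n k).rOut + K ⊆ Ω := by
  obtain ⟨δ, hδ, hδΩ⟩ := hK.exists_cthickening_subset_open hΩ h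
  filter_upwards [(tendsto_order.1 (tendsto_bump_rOut (n := n))).2 δ hδ] with k hk
  refine subset_trans ?_ hδΩ
  rintro _ ⟨a, ha, b, hb, rfl⟩
  refine Metric.mem_cthickening_of_dist_le _ b _ _ hb ?_
  rw [mem_closedBall_zero_iff] at ha
  simpa using ha.trans hk.le

end Mollification

/-! ### Submodularity of the area -/

section Area

open scoped Convolution Pointwise

variable {n : ℕ}

local notation "𝔼" => EuclideanSpace ℝ (Fin n)

variable {Ω : Set (EuclideanSpace ℝ (Fin n))} {u v : EuclideanSpace ℝ (Fin n) → ℝ}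

lemma integrable_mul_of_hasCompactSupport {μ : Measure 𝔼} (hu : Integrable u μ) {f : 𝔼 → ℝ}
    (hf : Continuous f) (hc : HasCompactSupport f) : Integrable (fun x => u x * f x) μ := by
  obtain ⟨C, hC⟩ := hc.exists_bound_of_continuous hf
  exact hu.mul_bdd (c := C) hf.aestronglyMeasurable (Eventually.of_forall hC)

lemma integrable_mul_div {μ : Measure 𝔼} (hu : Integrable u μ) {g : 𝔼 → 𝔼} (hg : ContDiff ℝ 1 g)
    (hc : HasCompactSupport g) : Integrable (fun x => u x * div g x) μ :=
  integrable_mul_of_hasCompactSupport hu (continuous_div hg) (hasCompactSupport_div hc)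

lemma integral_mul_div_le_totalVariation (hu : MemBV Ω u) {g : 𝔼 → 𝔼} (hg : IsTest Ω g)
    (h1 : ∀ x, ‖g x‖ ≤ 1) : ∫ x in Ω, u x * div g x ≤ (totalVariation Ω u).toReal := by
  refine (ENNReal.ofReal_le_iff_le_toReal hu.2.ne).1 ?_
  exact le_iSup_of_le g (le_iSup_of_le hg (le_iSup_of_le h1 le_rfl))

/-- In each test pair `g₀` contributes at most `|Ω|` and `g` at most the total variation. Finiteness
makes `(area Ω u).toReal` an honest upper bound for the pairings. -/
lemma area_lt_top (hΩ : volume Ω < ∞) (hu : MemBV Ω u) : area Ω u < ∞ := by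
  refine lt_of_le_of_lt (b := volume Ω + totalVariation Ω u) ?_ (ENNReal.add_lt_top.2 ⟨hΩ, hu.2⟩)
  refine iSup_le fun g₀ => iSup_le fun g => iSup_le fun hg₀ => iSup_le fun hg => iSup_le fun h => ?_
  have hi₀ : IntegrableOn g₀ Ω :=
    (hg₀.1.continuous.integrable_of_hasCompactSupport hg₀.2.1).integrableOn
  have h0 : ∀ x, g₀ x ≤ 1 := fun x => by nlinarith [h x, sq_nonneg ‖g x‖, sq_nonneg (g₀ x - 1)]
  have h1 : ∀ x, ‖g x‖ ≤ 1 := fun x => by nlinarith [h x, sq_nonneg (g₀ x), sq_nonneg (‖g x‖ - 1)]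
  rw [integral_add hi₀ (integrable_mul_div hu.1 hg.1 hg.2.1)]
  refine ENNReal.ofReal_add_le.trans (add_le_add ?_ ?_)
  · refine ENNReal.ofReal_le_of_le_toReal ?_
    calc ∫ x in Ω, g₀ x ≤ ∫ x in Ω, (1 : ℝ) :=
          integral_mono hi₀ (integrableOn_const hΩ.ne) h0
      _ = (volume Ω).toReal := by simp [Measure.real]
  · exact le_iSup_of_le g (le_iSup_of_le hg (le_iSup_of_le h1 le_rfl))

lemma integral_le_area (hΩ : volume Ω < ∞) (hu : MemBV Ω u) {g₀ : 𝔼 → ℝ} {g : 𝔼 → 𝔼}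
    (hg₀ : IsTest Ω g₀) (hg : IsTest Ω g) (h : ∀ x, g₀ x ^ 2 + ‖g x‖ ^ 2 ≤ 1) :
    ∫ x in Ω, (g₀ x + u x * div g x) ≤ (area Ω u).toReal := by
  refine (ENNReal.ofReal_le_iff_le_toReal (area_lt_top hΩ hu).ne).1 ?_
  exact le_iSup_of_le g₀ (le_iSup_of_le g (le_iSup_of_le hg₀ (le_iSup_of_le hg
    (le_iSup_of_le h le_rfl))))

lemma isTest_zero {F : Type*} [NormedAddCommGroup F] [NormedSpace ℝ F] :
    IsTest Ω (0 : 𝔼 → F) :=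
  ⟨contDiff_const, HasCompactSupport.zero, by simp⟩

lemma toReal_area_le {c : ℝ} (h : ∀ (g₀ : 𝔼 → ℝ) (g : 𝔼 → 𝔼), IsTest Ω g₀ → IsTest Ω g →
    (∀ x, g₀ x ^ 2 + ‖g x‖ ^ 2 ≤ 1) → ∫ x in Ω, (g₀ x + u x * div g x) ≤ c) :
    (area Ω u).toReal ≤ c := by
  -- The zero test pair gives `c ≥ 0`, so nothing is lost in passing through `ENNReal.ofReal`.
  have hc : 0 ≤ c := by
    have := h 0 0 isTest_zero isTest_zero (by simp)
    have hd : ∀ x : 𝔼, div (0 : 𝔼 → 𝔼) x = 0 := fun x => by simp [div]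
    simpa [hd] using this
  refine ENNReal.toReal_le_of_le_ofReal hc ?_
  exact iSup_le fun g₀ => iSup_le fun g => iSup_le fun hg₀ => iSup_le fun hg => iSup_le fun hh =>
    ENNReal.ofReal_le_ofReal (h g₀ g hg₀ hg hh)

lemma setIntegral_eq_of_isTest {F : Type*} [NormedAddCommGroup F] [NormedSpace ℝ F] {f : 𝔼 → F}
    (hf : IsTest Ω f) {G : 𝔼 → ℝ} (h : ∀ x, f x = 0 → G x = 0) : ∫ x in Ω, G x = ∫ x, G x :=
  setIntegral_eq_integral_of_forall_compl_eq_zero fun x hx =>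
    h x (image_eq_zero_of_notMem_tsupport fun hx' => hx (hf.2.2 hx'))

lemma integral_mul_div_eq {W : 𝔼 → ℝ} (hW : ContDiff ℝ 1 W) {g : 𝔼 → 𝔼} (hg : ContDiff ℝ 1 g)
    (hc : HasCompactSupport g) :
    ∫ x, W x * div g x = - ∫ x, fderiv ℝ W x (g x) := by
  have hWd := hW.continuous_fderiv one_ne_zero
  have hgd := hg.continuous_fderiv one_ne_zero
  have hcomp : ∀ i, HasCompactSupport fun x => g x i := fun i =>
    hc.comp_left (g := fun z : 𝔼 => z i) (by simp)
  have hgi : ∀ i, ContDiff ℝ 1 fun x => g x i := fun i => by fun_prop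
  have hfd : ∀ i x, (fderiv ℝ g x (EuclideanSpace.single i 1)) i
      = fderiv ℝ (fun y => g y i) x (EuclideanSpace.single i 1) := by
    intro i x
    have := ((EuclideanSpace.proj i : 𝔼 →L[ℝ] ℝ).hasFDerivAt.comp x
      (hg.differentiable one_ne_zero x).hasFDerivAt).fderiv
    have h2 : (fun y => g y i) = (EuclideanSpace.proj i : 𝔼 →L[ℝ] ℝ) ∘ g := rfl
    rw [h2, this]
    simp
  have hsum : ∀ x, fderiv ℝ W x (g x)
      = ∑ i, fderiv ℝ W x (EuclideanSpace.single i 1) * g x i := by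
    intro x
    conv_lhs => rw [← (EuclideanSpace.basisFun (Fin n) ℝ).sum_repr (g x)]
    simp [map_sum, mul_comm]
  have hI1 : ∀ i, Integrable fun x => fderiv ℝ W x (EuclideanSpace.single i 1) * g x i :=
    fun i => Continuous.integrable_of_hasCompactSupport (by fun_prop) ((hcomp i).mul_left)
  have hI2 : ∀ i, Integrable fun x =>
      W x * fderiv ℝ (fun y => g y i) x (EuclideanSpace.single i 1) := fun i => by
    have := (hgi i).continuous_fderiv one_ne_zero
    exact Continuous.integrable_of_hasCompactSupport (by fun_prop)
      (((hcomp i).fderiv_apply ℝ _).mul_left)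
  have hI3 : ∀ i, Integrable fun x => W x * g x i := fun i =>
    Continuous.integrable_of_hasCompactSupport (by fun_prop) ((hcomp i).mul_left)
  simp_rw [hsum]
  unfold div
  simp_rw [hfd, Finset.mul_sum]
  rw [integral_finsetSum _ fun i _ => hI1 i, integral_finsetSum _ fun i _ => hI2 i,
    ← Finset.sum_neg_distrib]
  refine Finset.sum_congr rfl fun i _ => ?_
  exact integral_mul_fderiv_eq_neg_fderiv_mul_of_integrable (hI1 i) (hI2 i) (hI3 i)
    (fun x _ => hW.differentiable one_ne_zero x) (fun x _ => (hgi i).differentiable one_ne_zero x)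

/-- Mollifying does not increase area away from the boundary: the mollifier is moved onto the test
pair, whose support stays in `Ω` by the margin `φ.rOut` and whose norm stays at most `1` by Jensen.
-/
lemma integral_add_mollify_mul_div_le_area (hΩ : IsOpen Ω) (hΩv : volume Ω < ∞) (hu : MemBV Ω u)
    (φ : ContDiffBump (0 : 𝔼)) {g₀ : 𝔼 → ℝ} {g : 𝔼 → 𝔼} (hg₀ : ContDiff ℝ 1 g₀)
    (hc₀ : HasCompactSupport g₀) (hg : ContDiff ℝ 1 g) (hc : HasCompactSupport g)
    (hs₀ : Metric.closedBall 0 φ.rOut + tsupport g₀ ⊆ Ω)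
    (hs : Metric.closedBall 0 φ.rOut + tsupport g ⊆ Ω) (h : ∀ x, g₀ x ^ 2 + ‖g x‖ ^ 2 ≤ 1) :
    ∫ x, (g₀ x + mollify φ (Ω.indicator u) x * div g x) ≤ (area Ω u).toReal := by
  have ht₀ := isTest_mollify φ hg₀ hc₀ hs₀
  have ht := isTest_mollify φ hg hc hs
  have hi₀ := hg₀.continuous.integrable_of_hasCompactSupport (μ := volume) hc₀
  have hu' : Integrable (Ω.indicator u) := (integrable_indicator_iff hΩ.measurableSet).2 hu.1
  have key := integral_le_area hΩv hu ht₀ ht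
    (sq_mollify_add_sq_norm_mollify_le φ hg₀.continuous hc₀ hg.continuous hc h)
  rw [integral_add hi₀ (integrable_mul_div (integrable_mollify φ hu') hg hc),
    integral_mollify_indicator_mul_div φ hΩ.measurableSet hu.1 hg hc, ← integral_mollify φ hi₀,
    ← setIntegral_eq_of_isTest ht₀ (G := mollify φ g₀) (fun x hx => hx)]
  rwa [integral_add (integrable_mollify φ hi₀).integrableOn
    (integrable_mul_div hu.1 ht.1 ht.2.1)] at key

/-- A smooth approximation of the positive part. -/
noncomputable def softPos (δ t : ℝ) : ℝ := (t + √(t ^ 2 + δ ^ 2)) / 2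

/-- The derivative of `softPos δ`. -/
noncomputable def softStep (δ t : ℝ) : ℝ := (1 + t / √(t ^ 2 + δ ^ 2)) / 2

lemma hasDerivAt_softPos {δ : ℝ} (hδ : 0 < δ) (t : ℝ) :
    HasDerivAt (softPos δ) (softStep δ t) t := by
  have hne : t ^ 2 + δ ^ 2 ≠ 0 := by positivity
  have h1 : HasDerivAt (fun t : ℝ => t ^ 2 + δ ^ 2) (2 * t) t := by
    simpa using (hasDerivAt_pow 2 t).add_const (δ ^ 2)
  have h2 := ((hasDerivAt_id t).add (h1.sqrt hne)).div_const 2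
  refine h2.congr_deriv ?_
  unfold softStep
  field_simp

lemma contDiff_softStep {δ : ℝ} (hδ : 0 < δ) : ContDiff ℝ 1 (softStep δ) := by
  have h : ContDiff ℝ 1 fun t : ℝ => √(t ^ 2 + δ ^ 2) :=
    ContDiff.sqrt (by fun_prop) fun t => by positivity
  unfold softStep
  exact ((contDiff_const.add (contDiff_id.div h fun t => by positivity))).div_const 2

lemma contDiff_softPos {δ : ℝ} (hδ : 0 < δ) : ContDiff ℝ 1 (softPos δ) := by
  have h : ContDiff ℝ 1 fun t : ℝ => √(t ^ 2 + δ ^ 2) :=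
    ContDiff.sqrt (by fun_prop) fun t => by positivity
  unfold softPos
  exact (contDiff_id.add h).div_const 2

lemma softStep_mem_Icc {δ : ℝ} (t : ℝ) : softStep δ t ∈ Icc (0 : ℝ) 1 := by
  have h : |t / √(t ^ 2 + δ ^ 2)| ≤ 1 := by
    rw [abs_div, abs_of_nonneg (Real.sqrt_nonneg _)]
    refine div_le_one_of_le₀ (Real.abs_le_sqrt ?_) (Real.sqrt_nonneg _)
    nlinarith [sq_nonneg δ]
  have := abs_le.1 h
  constructor <;> · unfold softStep; linarith

lemma abs_softPos_sub_le {δ : ℝ} (hδ : 0 < δ) (t : ℝ) : |softPos δ t - max t 0| ≤ δ := by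
  have h1 : |t| ≤ √(t ^ 2 + δ ^ 2) := Real.abs_le_sqrt (by nlinarith [sq_nonneg δ])
  have h2 : √(t ^ 2 + δ ^ 2) ≤ |t| + δ := by
    refine Real.sqrt_le_iff.2 ⟨by positivity, ?_⟩
    nlinarith [sq_abs t, abs_nonneg t]
  have h3 : max t 0 = (t + |t|) / 2 := by
    rcases le_total t 0 with h | h
    · rw [max_eq_right h, abs_of_nonpos h]; ring
    · rw [max_eq_left h, abs_of_nonneg h]; ring
  rw [h3, softPos, abs_le]
  constructor <;> linarith

/-- Convexity of the unit ball of `ℝ × ℝⁿ`; this keeps the exchanged test pairs admissible. -/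
lemma sq_convexCombo_add_sq_norm_le {s a b : ℝ} {x y : 𝔼} (hs : s ∈ Icc (0 : ℝ) 1)
    (hx : a ^ 2 + ‖x‖ ^ 2 ≤ 1) (hy : b ^ 2 + ‖y‖ ^ 2 ≤ 1) :
    (s * a + (1 - s) * b) ^ 2 + ‖s • x + (1 - s) • y‖ ^ 2 ≤ 1 := by
  have h1 : ‖s • x + (1 - s) • y‖ ≤ s * ‖x‖ + (1 - s) * ‖y‖ := by
    refine (norm_add_le _ _).trans ?_
    rw [norm_smul, norm_smul, Real.norm_of_nonneg hs.1, Real.norm_of_nonneg (by linarith [hs.2])]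
  have h2 : ‖s • x + (1 - s) • y‖ ^ 2 ≤ (s * ‖x‖ + (1 - s) * ‖y‖) ^ 2 := by gcongr
  have h3 : 0 ≤ s * (1 - s) := mul_nonneg hs.1 (by linarith [hs.2])
  nlinarith [mul_nonneg h3 (sq_nonneg (a - b)), mul_nonneg h3 (sq_nonneg (‖x‖ - ‖y‖)),
    mul_le_mul_of_nonneg_left hx hs.1,
    mul_le_mul_of_nonneg_left hy (sub_nonneg.2 hs.2)]

lemma integrable_fderiv_apply {W : 𝔼 → ℝ} (hW : ContDiff ℝ 1 W) {g : 𝔼 → 𝔼}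
    (hg : ContDiff ℝ 1 g) (hc : HasCompactSupport g) :
    Integrable fun x => fderiv ℝ W x (g x) := by
  have := hW.continuous_fderiv one_ne_zero
  have hg' := hg.continuous
  refine Continuous.integrable_of_hasCompactSupport (by fun_prop) (hc.mono fun x hx => ?_)
  contrapose! hx
  simp only [Function.mem_support, not_not] at hx ⊢
  simp [hx]

lemma integral_add_mul_div_eq {W f₀ : 𝔼 → ℝ} (hW : ContDiff ℝ 1 W) (hf₀ : Integrable f₀)
    {g : 𝔼 → 𝔼} (hg : ContDiff ℝ 1 g) (hc : HasCompactSupport g) :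
    ∫ x, (f₀ x + W x * div g x) = ∫ x, (f₀ x - fderiv ℝ W x (g x)) := by
  have hi : Integrable fun x => W x * div g x :=
    (hW.continuous.mul (continuous_div hg)).integrable_of_hasCompactSupport
      (hasCompactSupport_div hc).mul_left
  rw [integral_add hf₀ hi, integral_sub hf₀ (integrable_fderiv_apply hW hg hc),
    integral_mul_div_eq hW hg hc, sub_eq_add_neg]

/-- The smoothed maximum has derivative `s U' + (1-s) V'` and the smoothed minimum `(1-s) U' + s
V'`; the terms are regrouped by `U'` and `V'`. -/
lemma fderiv_softMax_add_fderiv_softMin {U V : 𝔼 → ℝ} {x : 𝔼} (hU : DifferentiableAt ℝ U x)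
    (hV : DifferentiableAt ℝ V x) {δ : ℝ} (hδ : 0 < δ) (y z : 𝔼) {s : ℝ}
    (hs : s = softStep δ (U x - V x)) :
    fderiv ℝ (fun x => V x + softPos δ (U x - V x)) x y
      + fderiv ℝ (fun x => U x - softPos δ (U x - V x)) x z
      = fderiv ℝ U x (s • y + (1 - s) • z) + fderiv ℝ V x (s • z + (1 - s) • y) := by
  have hUx := hU.hasFDerivAt
  have hVx := hV.hasFDerivAt
  have hb : HasFDerivAt (fun x => softPos δ (U x - V x))
      (softStep δ (U x - V x) • (fderiv ℝ U x - fderiv ℝ V x)) x :=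
    (hasDerivAt_softPos hδ (U x - V x)).comp_hasFDerivAt (f := fun x => U x - V x) x (hUx.sub hVx)
  have hm1 : fderiv ℝ (fun x => V x + softPos δ (U x - V x)) x
      = fderiv ℝ V x + softStep δ (U x - V x) • (fderiv ℝ U x - fderiv ℝ V x) :=
    (hVx.add hb).fderiv
  have hm2 : fderiv ℝ (fun x => U x - softPos δ (U x - V x)) x
      = fderiv ℝ U x - softStep δ (U x - V x) • (fderiv ℝ U x - fderiv ℝ V x) :=
    (hUx.sub hb).fderiv
  rw [hm1, hm2, ← hs]
  simp only [add_apply, sub_apply, smul_apply, map_add, map_smul, smul_eq_mul]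
  ring

/-- For `C¹` functions `U`, `V` a smoothed version of the maximum and minimum of `U`, `V`
paired with two test fields is the pairing of `U` and `V` with pointwise convex combinations of
these fields. -/
lemma integral_softMax_add_integral_softMin {U V : 𝔼 → ℝ} (hU : ContDiff ℝ 1 U)
    (hV : ContDiff ℝ 1 V) {δ : ℝ} (hδ : 0 < δ) {g₀ h₀ : 𝔼 → ℝ} {g h : 𝔼 → 𝔼}
    (hg₀ : ContDiff ℝ 1 g₀) (hgc₀ : HasCompactSupport g₀) (hg : ContDiff ℝ 1 g)
    (hgc : HasCompactSupport g)
    (hh₀ : ContDiff ℝ 1 h₀) (hhc₀ : HasCompactSupport h₀) (hh : ContDiff ℝ 1 h)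
    (hhc : HasCompactSupport h) {s : 𝔼 → ℝ} (hs : s = fun x => softStep δ (U x - V x)) :
    (∫ x, (g₀ x + (V x + softPos δ (U x - V x)) * div g x))
      + ∫ x, (h₀ x + (U x - softPos δ (U x - V x)) * div h x)
    = (∫ x, ((s x * g₀ x + (1 - s x) * h₀ x)
          + U x * div (fun y => s y • g y + (1 - s y) • h y) x))
      + ∫ x, ((s x * h₀ x + (1 - s x) * g₀ x)
          + V x * div (fun y => s y • h y + (1 - s y) • g y) x) := by
  have hsC : ContDiff ℝ 1 s := by
    rw [hs]; exact (contDiff_softStep hδ).comp (hU.sub hV)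
  have hbC : ContDiff ℝ 1 fun x => softPos δ (U x - V x) :=
    (contDiff_softPos hδ).comp (hU.sub hV)
  have hP : ContDiff ℝ 1 fun y => s y • g y + (1 - s y) • h y := by fun_prop
  have hQ : ContDiff ℝ 1 fun y => s y • h y + (1 - s y) • g y := by fun_prop
  have hs1 : ContDiff ℝ 1 fun x => 1 - s x := by fun_prop
  have hsm : ∀ {a b : 𝔼 → ℝ} {p r : 𝔼 → 𝔼}, HasCompactSupport p →
      HasCompactSupport r → HasCompactSupport fun y => a y • p y + b y • r y := by
    intro a b p r hp hr
    have h1 : HasCompactSupport fun y => a y • p y := HasCompactSupport.smul_left (f := a) hp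
    have h2 : HasCompactSupport fun y => b y • r y := HasCompactSupport.smul_left (f := b) hr
    exact HasCompactSupport.add h1 h2
  have hPc : HasCompactSupport fun y => s y • g y + (1 - s y) • h y :=
    hsm hgc hhc
  have hQc : HasCompactSupport fun y => s y • h y + (1 - s y) • g y :=
    hsm hhc hgc
  have hi : ∀ {f k : 𝔼 → ℝ}, ContDiff ℝ 1 f → ContDiff ℝ 1 k → HasCompactSupport k →
      Integrable fun x => f x * k x := fun hf hk hkc =>
    (hf.continuous.mul hk.continuous).integrable_of_hasCompactSupport hkc.mul_left
  have hmax : ContDiff ℝ 1 fun x => V x + softPos δ (U x - V x) := hV.add hbC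
  have hmin : ContDiff ℝ 1 fun x => U x - softPos δ (U x - V x) := hU.sub hbC
  have hig₀ := hg₀.continuous.integrable_of_hasCompactSupport (μ := volume) hgc₀
  have hih₀ := hh₀.continuous.integrable_of_hasCompactSupport (μ := volume) hhc₀
  have hiP₀ : Integrable fun x => s x * g₀ x + (1 - s x) * h₀ x :=
    (hi hsC hg₀ hgc₀).add (hi hs1 hh₀ hhc₀)
  have hiQ₀ : Integrable fun x => s x * h₀ x + (1 - s x) * g₀ x :=
    (hi hsC hh₀ hhc₀).add (hi hs1 hg₀ hgc₀)
  have hsub : ∀ {f₀ W : 𝔼 → ℝ} {f : 𝔼 → 𝔼}, Integrable f₀ → ContDiff ℝ 1 W → ContDiff ℝ 1 f →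
      HasCompactSupport f → Integrable fun x => f₀ x - fderiv ℝ W x (f x) :=
    fun hf₀ hW hf hfc => hf₀.sub (integrable_fderiv_apply hW hf hfc)
  rw [integral_add_mul_div_eq hmax hig₀ hg hgc, integral_add_mul_div_eq hmin hih₀ hh hhc,
    integral_add_mul_div_eq hU hiP₀ hP hPc, integral_add_mul_div_eq hV hiQ₀ hQ hQc,
    ← integral_add (hsub hig₀ hmax hg hgc) (hsub hih₀ hmin hh hhc),
    ← integral_add (hsub hiP₀ hU hP hPc) (hsub hiQ₀ hV hQ hQc)]
  congr 1
  ext x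
  have := fderiv_softMax_add_fderiv_softMin (hU.differentiable one_ne_zero x)
    (hV.differentiable one_ne_zero x) hδ (g x) (h x) (congrFun hs x)
  linarith

lemma tsupport_combo_subset {F : Type*} [NormedAddCommGroup F] [NormedSpace ℝ F] {s t : 𝔼 → ℝ}
    {f k : 𝔼 → F} {K : Set 𝔼} (hK : IsClosed K) (hf : tsupport f ⊆ K) (hk : tsupport k ⊆ K) :
    tsupport (fun x => s x • f x + t x • k x) ⊆ K := by
  refine closure_minimal (fun x hx => ?_) hK
  by_contra hxK
  refine hx ?_
  simp [image_eq_zero_of_notMem_tsupport fun h => hxK (hf h),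
    image_eq_zero_of_notMem_tsupport fun h => hxK (hk h)]

/-- Submodularity of the area functional. -/
theorem area_max_add_area_min_le (hΩ : IsOpen Ω) (hΩv : volume Ω < ∞) (hu : MemBV Ω u)
    (hv : MemBV Ω v) :
    (area Ω fun x => max (u x) (v x)).toReal + (area Ω fun x => min (u x) (v x)).toReal
      ≤ (area Ω u).toReal + (area Ω v).toReal := by
  -- The two suprema are independent, so each is taken with the other test pair held fixed.
  suffices H : ∀ (g₀ : 𝔼 → ℝ) (g : 𝔼 → 𝔼) (h₀ : 𝔼 → ℝ) (h : 𝔼 → 𝔼), IsTest Ω g₀ → IsTest Ω g →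
      (∀ x, g₀ x ^ 2 + ‖g x‖ ^ 2 ≤ 1) → IsTest Ω h₀ → IsTest Ω h →
      (∀ x, h₀ x ^ 2 + ‖h x‖ ^ 2 ≤ 1) →
      (∫ x in Ω, (g₀ x + max (u x) (v x) * div g x))
        + (∫ x in Ω, (h₀ x + min (u x) (v x) * div h x))
      ≤ (area Ω u).toReal + (area Ω v).toReal by
    rw [← le_sub_iff_add_le]
    refine toReal_area_le fun g₀ g hg₀ hg hg1 => ?_
    rw [le_sub_comm]
    refine toReal_area_le fun h₀ h hh₀ hh hh1 => ?_
    linarith [H g₀ g h₀ h hg₀ hg hg1 hh₀ hh hh1]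
  intro g₀ g h₀ h hg₀ hg hg1 hh₀ hh hh1
  set U : ℕ → 𝔼 → ℝ := fun k => mollify (bump n k) (Ω.indicator u) with hUdef
  set V : ℕ → 𝔼 → ℝ := fun k => mollify (bump n k) (Ω.indicator v) with hVdef
  have hui : Integrable (Ω.indicator u) := (integrable_indicator_iff hΩ.measurableSet).2 hu.1
  have hvi : Integrable (Ω.indicator v) := (integrable_indicator_iff hΩ.measurableSet).2 hv.1
  have hUC : ∀ k, ContDiff ℝ 1 (U k) := fun k =>
    contDiff_mollify _ hui.locallyIntegrable
  have hVC : ∀ k, ContDiff ℝ 1 (V k) := fun k =>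
    contDiff_mollify _ hvi.locallyIntegrable
  set δ : ℕ → ℝ := fun k => 1 / ((k : ℝ) + 1) with hδdef
  have hδ : ∀ k, 0 < δ k := fun k => by positivity
  -- The exchanged pairs mix all four fields, so one compact set has to carry all the supports.
  set K := (tsupport g₀ ∪ tsupport g) ∪ (tsupport h₀ ∪ tsupport h) with hKdef
  have hK : IsCompact K := (hg₀.2.1.isCompact.union hg.2.1.isCompact).union
    (hh₀.2.1.isCompact.union hh.2.1.isCompact)
  have hKΩ : K ⊆ Ω := union_subset (union_subset hg₀.2.2 hg.2.2) (union_subset hh₀.2.2 hh.2.2)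
  have hbound : ∀ᶠ k in atTop,
      (∫ x, (g₀ x + (V k x + softPos (δ k) (U k x - V k x)) * div g x))
        + ∫ x, (h₀ x + (U k x - softPos (δ k) (U k x - V k x)) * div h x)
      ≤ (area Ω u).toReal + (area Ω v).toReal := by
    filter_upwards [eventually_closedBall_bump_add_subset hK hΩ hKΩ] with k hk
    rw [integral_softMax_add_integral_softMin (hUC k) (hVC k) (hδ k) hg₀.1 hg₀.2.1 hg.1 hg.2.1
      hh₀.1 hh₀.2.1 hh.1 hh.2.1 rfl]
    have hsC : ContDiff ℝ 1 fun x => softStep (δ k) (U k x - V k x) :=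
      (contDiff_softStep (hδ k)).comp ((hUC k).sub (hVC k))
    have sg₀ : tsupport g₀ ⊆ K := fun x hx => Or.inl (Or.inl hx)
    have sg : tsupport g ⊆ K := fun x hx => Or.inl (Or.inr hx)
    have sh₀ : tsupport h₀ ⊆ K := fun x hx => Or.inr (Or.inl hx)
    have sh : tsupport h ⊆ K := fun x hx => Or.inr (Or.inr hx)
    have := hg₀.1
    have := hg.1
    have := hh₀.1
    have := hh.1
    have hcs : ∀ {F : Type} [NormedAddCommGroup F] (f : 𝔼 → F), tsupport f ⊆ K →
        HasCompactSupport f := fun f hf => hK.of_isClosed_subset (isClosed_tsupport f) hf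
    refine add_le_add ?_ ?_
    · refine integral_add_mollify_mul_div_le_area hΩ hΩv hu _ (by fun_prop) (hcs _ ?_)
        (by fun_prop) (hcs _ ?_) ((add_subset_add_left ?_).trans hk)
        ((add_subset_add_left ?_).trans hk)
        fun x => sq_convexCombo_add_sq_norm_le (softStep_mem_Icc _) (hg1 x) (hh1 x)
      · exact tsupport_combo_subset hK.isClosed sg₀ sh₀
      · exact tsupport_combo_subset hK.isClosed sg sh
      · exact tsupport_combo_subset hK.isClosed sg₀ sh₀
      · exact tsupport_combo_subset hK.isClosed sg sh
    · refine integral_add_mollify_mul_div_le_area hΩ hΩv hv _ (by fun_prop) (hcs _ ?_)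
        (by fun_prop) (hcs _ ?_) ((add_subset_add_left ?_).trans hk)
        ((add_subset_add_left ?_).trans hk)
        fun x => sq_convexCombo_add_sq_norm_le (softStep_mem_Icc _) (hh1 x) (hg1 x)
      · exact tsupport_combo_subset hK.isClosed sh₀ sg₀
      · exact tsupport_combo_subset hK.isClosed sh sg
      · exact tsupport_combo_subset hK.isClosed sh₀ sg₀
      · exact tsupport_combo_subset hK.isClosed sh sg
  -- The `L¹` errors of the two mollifications, plus the uniform error `δ k` of `softPos` integrated
  -- over `Ω`.
  set err : ℕ → ℝ := fun k => (∫ x, |U k x - Ω.indicator u x|) + (∫ x, |V k x - Ω.indicator v x|)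
    + δ k * (volume Ω).toReal with herr
  have herr0 : Tendsto err atTop (𝓝 0) := by
    have := ((tendsto_integral_abs_mollify_sub hui).add
      (tendsto_integral_abs_mollify_sub hvi)).add
      ((tendsto_one_div_add_atTop_nhds_zero_nat (𝕜 := ℝ)).mul_const (volume Ω).toReal)
    simpa [err, U, V, δ] using this
  have hab : ∀ f : 𝔼 → ℝ, ∀ k, Integrable f →
      Integrable fun x => |mollify (bump n k) f x - f x| :=
    fun f k hf => ((integrable_mollify _ hf).sub hf).abs
  -- A bound on `div f` turns `L¹` closeness of `m` and `M` into closeness of the pairings. It is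
  -- used for the max and for the min, each 1-Lipschitz in every argument.
  have hest : ∀ {m : 𝔼 → ℝ} {M : 𝔼 → ℝ} {f₀ : 𝔼 → ℝ} {f : 𝔼 → 𝔼} (k : ℕ), IsTest Ω f₀ →
      IsTest Ω f → IntegrableOn m Ω → ContDiff ℝ 1 M → ∀ C : ℝ, (∀ x, ‖div f x‖ ≤ C) →
      (∀ x ∈ Ω, |m x - M x| ≤ |U k x - Ω.indicator u x| + |V k x - Ω.indicator v x| + δ k) →
      ∫ x in Ω, (f₀ x + m x * div f x) ≤ (∫ x, (f₀ x + M x * div f x)) + C * err k := by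
    intro m M f₀ f k hf₀ hf hm hM C hC hmM
    have hif₀ := hf₀.1.continuous.integrable_of_hasCompactSupport (μ := volume) hf₀.2.1
    have hMi : Integrable fun x => M x * div f x :=
      (hM.continuous.mul (continuous_div hf.1)).integrable_of_hasCompactSupport
        (hasCompactSupport_div hf.2.1).mul_left
    have hsup : ∀ x ∉ Ω, f₀ x + M x * div f x = 0 := fun x hx => by
      rw [image_eq_zero_of_notMem_tsupport fun h' => hx (hf₀.2.2 h'),
        image_eq_zero_of_notMem_tsupport (f := div f)
          fun h' => hx (hf.2.2 (tsupport_div_subset f h'))]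
      simp
    have hI1 : IntegrableOn (fun x => f₀ x + m x * div f x) Ω :=
      hif₀.integrableOn.add (integrable_mul_div hm hf.1 hf.2.1)
    have hI2 : IntegrableOn (fun x => f₀ x + M x * div f x) Ω :=
      hif₀.integrableOn.add hMi.integrableOn
    rw [← setIntegral_eq_integral_of_forall_compl_eq_zero hsup, ← sub_le_iff_le_add',
      ← integral_sub hI1 hI2]
    have hUi : IntegrableOn (fun x => |U k x - Ω.indicator u x|) Ω := (hab _ k hui).integrableOn
    have hVi : IntegrableOn (fun x => |V k x - Ω.indicator v x|) Ω := (hab _ k hvi).integrableOn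
    have hUVi : IntegrableOn
        (fun x => |U k x - Ω.indicator u x| + |V k x - Ω.indicator v x|) Ω := hUi.add hVi
    have hδi : IntegrableOn (fun _ : 𝔼 => δ k) Ω := integrableOn_const hΩv.ne
    have hC0 : 0 ≤ C := (norm_nonneg _).trans (hC 0)
    calc ∫ x in Ω, (f₀ x + m x * div f x - (f₀ x + M x * div f x))
        ≤ ∫ x in Ω, C * (|U k x - Ω.indicator u x| + |V k x - Ω.indicator v x| + δ k) := by
          refine setIntegral_mono_on (hI1.sub hI2)
            ((hUVi.add hδi).const_mul C) hΩ.measurableSet fun x hx => ?_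
          calc f₀ x + m x * div f x - (f₀ x + M x * div f x) = div f x * (m x - M x) := by ring
            _ ≤ |div f x| * |m x - M x| := by rw [← abs_mul]; exact le_abs_self _
            _ ≤ _ := mul_le_mul (hC x) (hmM x hx) (abs_nonneg _) hC0
      _ = C * ((∫ x in Ω, |U k x - Ω.indicator u x|) + (∫ x in Ω, |V k x - Ω.indicator v x|)
            + δ k * (volume Ω).toReal) := by
          rw [integral_const_mul, integral_add hUVi hδi, integral_add hUi hVi]
          simp [Measure.real, mul_comm]
      _ ≤ C * err k := by
          refine mul_le_mul_of_nonneg_left ?_ hC0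
          refine add_le_add (add_le_add ?_ ?_) le_rfl
          · exact setIntegral_le_integral (hab _ k hui) (Eventually.of_forall fun x => abs_nonneg _)
          · exact setIntegral_le_integral (hab _ k hvi) (Eventually.of_forall fun x => abs_nonneg _)
  obtain ⟨C, hC⟩ := (hasCompactSupport_div hg.2.1).exists_bound_of_continuous (continuous_div hg.1)
  obtain ⟨C', hC'⟩ := (hasCompactSupport_div hh.2.1).exists_bound_of_continuous
    (continuous_div hh.1)
  have hmax : IntegrableOn (fun x => max (u x) (v x)) Ω := hu.1.sup hv.1
  have hmin : IntegrableOn (fun x => min (u x) (v x)) Ω := hu.1.inf hv.1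
  have hbC : ∀ k, ContDiff ℝ 1 fun x => softPos (δ k) (U k x - V k x) := fun k =>
    (contDiff_softPos (hδ k)).comp ((hUC k).sub (hVC k))
  have hptmax : ∀ a b a' b' d : ℝ, 0 < d →
      |max a b - (b' + softPos d (a' - b'))| ≤ |a' - a| + |b' - b| + d := by
    intro a b a' b' d hd
    have h1 := abs_softPos_sub_le hd (a' - b')
    have h2 : b' + max (a' - b') 0 = max a' b' := by rw [← max_add_add_left]; simp
    have h3 := abs_max_sub_max_le_max a b a' b'
    have h4 : max |a - a'| |b - b'| ≤ |a - a'| + |b - b'| :=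
      max_le (by linarith [abs_nonneg (b - b')]) (by linarith [abs_nonneg (a - a')])
    rw [abs_sub_comm a a', abs_sub_comm b b'] at h4
    rw [abs_sub_comm a a', abs_sub_comm b b'] at h3
    have h5 : max a b - (b' + softPos d (a' - b'))
        = (max a b - max a' b') - (softPos d (a' - b') - max (a' - b') 0) := by
      rw [← h2]; ring
    rw [h5]
    exact (abs_sub _ _).trans (by linarith)
  have hptmin : ∀ a b a' b' d : ℝ, 0 < d →
      |min a b - (a' - softPos d (a' - b'))| ≤ |a' - a| + |b' - b| + d := by
    intro a b a' b' d hd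
    have h1 := abs_softPos_sub_le hd (a' - b')
    have h2 : a' - max (a' - b') 0 = min a' b' := by
      rcases le_total a' b' with h | h
      · rw [max_eq_right (by linarith), min_eq_left h]; ring
      · rw [max_eq_left (by linarith), min_eq_right h]; ring
    have h3 := abs_min_sub_min_le_max a b a' b'
    have h4 : max |a - a'| |b - b'| ≤ |a - a'| + |b - b'| :=
      max_le (by linarith [abs_nonneg (b - b')]) (by linarith [abs_nonneg (a - a')])
    rw [abs_sub_comm a a', abs_sub_comm b b'] at h4
    rw [abs_sub_comm a a', abs_sub_comm b b'] at h3
    have h5 : min a b - (a' - softPos d (a' - b'))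
        = (min a b - min a' b') + (softPos d (a' - b') - max (a' - b') 0) := by
      rw [← h2]; ring
    rw [h5]
    exact (abs_add_le _ _).trans (by linarith)
  have hlim : Tendsto (fun k => (area Ω u).toReal + (area Ω v).toReal + (C + C') * err k) atTop
      (𝓝 ((area Ω u).toReal + (area Ω v).toReal)) := by
    simpa using (herr0.const_mul (C + C')).const_add ((area Ω u).toReal + (area Ω v).toReal)
  refine ge_of_tendsto hlim ?_
  filter_upwards [hbound] with k hk
  have i1 := hest k hg₀ hg hmax ((hVC k).add (hbC k)) C hC fun x hx => by
    rw [indicator_of_mem hx, indicator_of_mem hx]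
    exact hptmax _ _ _ _ _ (hδ k)
  have i2 := hest k hh₀ hh hmin ((hUC k).sub (hbC k)) C' hC' fun x hx => by
    rw [indicator_of_mem hx, indicator_of_mem hx]
    exact hptmin _ _ _ _ _ (hδ k)
  linarith

end Area

/-! ### Total variation bounds the derivatives of mollifications -/

section DerivativeBound

open scoped Convolution Pointwise Manifold

variable {n : ℕ}

local notation "𝔼" => EuclideanSpace ℝ (Fin n)

variable {Ω : Set (EuclideanSpace ℝ (Fin n))} {u : EuclideanSpace ℝ (Fin n) → ℝ}

lemma exists_cutoff {K Ω : Set 𝔼} (hK : IsCompact K) (hΩ : IsOpen Ω) (h : K ⊆ Ω) :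
    ∃ χ : 𝔼 → ℝ, IsTest Ω χ ∧ (∀ x, χ x ∈ Icc (0 : ℝ) 1) ∧ ∀ x ∈ K, χ x = 1 := by
  obtain ⟨δ, hδ, hδΩ⟩ := hK.exists_cthickening_subset_open hΩ h
  obtain ⟨χ, hχC, hχr, hχs, hχ1⟩ := exists_contMDiff_support_eq_eq_one_iff (n := 1) 𝓘(ℝ, 𝔼)
    (Metric.isOpen_thickening (δ := δ) (E := K)) hK.isClosed (Metric.self_subset_thickening hδ K)
  have hts : tsupport χ ⊆ Metric.cthickening δ K := by
    rw [tsupport, hχs]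
    exact Metric.closure_thickening_subset_cthickening δ K
  refine ⟨χ, ⟨hχC.contDiff, ?_, hts.trans hδΩ⟩, fun x => hχr (mem_range_self x),
    fun x hx => (hχ1 x).1 hx⟩
  exact hK.cthickening.of_isClosed_subset (isClosed_tsupport χ) hts

/-- The right side is `t` times the smoothed sign `t / √(η + t²)`: replacing the sign by a smooth
function costs at most `√η`. -/
lemma abs_sub_sqrt_le {η t : ℝ} (hη : 0 < η) : |t| - √η ≤ t ^ 2 / √(η + t ^ 2) := by
  have hpos : 0 < √(η + t ^ 2) := Real.sqrt_pos.2 (by positivity)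
  rw [le_div_iff₀ hpos]
  have h1 : √(η + t ^ 2) ≤ √η + |t| := by
    refine Real.sqrt_le_iff.2 ⟨by positivity, ?_⟩
    nlinarith [Real.sq_sqrt hη.le, sq_abs t, mul_nonneg (Real.sqrt_nonneg η) (abs_nonneg t)]
  have h2 : |t| ≤ √(η + t ^ 2) := Real.abs_le_sqrt (by linarith)
  have h3 := Real.sqrt_nonneg η
  rcases le_total |t| √η with h | h
  · nlinarith [sq_nonneg t]
  · nlinarith [sq_abs t, Real.sq_sqrt hη.le]

/-- With `w = ∂ₑW`, the total variation is tested with the mollification of `-χ w / √(η + w²) e`, a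
smooth substitute for `-χ sign(w) e`; then `η → 0`. -/
lemma integral_cutoff_mul_abs_fderiv_le (hΩ : IsOpen Ω) (hu : MemBV Ω u)
    (φ : ContDiffBump (0 : 𝔼)) {e : 𝔼} (he : ‖e‖ = 1) {χ : 𝔼 → ℝ} (hχ : ContDiff ℝ 1 χ)
    (hc : HasCompactSupport χ) (hs : Metric.closedBall 0 φ.rOut + tsupport χ ⊆ Ω)
    (hr : ∀ x, χ x ∈ Icc (0 : ℝ) 1) :
    ∫ x, χ x * |fderiv ℝ (mollify φ (Ω.indicator u)) x e| ≤ (totalVariation Ω u).toReal := by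
  set W := mollify φ (Ω.indicator u) with hWdef
  have hui : Integrable (Ω.indicator u) := (integrable_indicator_iff hΩ.measurableSet).2 hu.1
  -- Two derivatives, because `w = ∂ₑW` enters the test field and must itself be `C¹`.
  have hW2 : ContDiff ℝ 2 W := contDiff_mollify φ hui.locallyIntegrable (m := 2)
  have hW : ContDiff ℝ 1 W := hW2.of_le one_le_two
  set w : 𝔼 → ℝ := fun x => fderiv ℝ W x e with hw
  have hwC : ContDiff ℝ 1 w := (hW2.fderiv_right (m := 1) le_rfl).clm_apply contDiff_const
  have hiχ : Integrable χ := hχ.continuous.integrable_of_hasCompactSupport hc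
  have hi : Integrable fun x => χ x * |w x| :=
    (hχ.continuous.mul hwC.continuous.abs).integrable_of_hasCompactSupport hc.mul_right
  have key : ∀ η : ℝ, 0 < η →
      (∫ x, χ x * |w x|) ≤ (totalVariation Ω u).toReal + √η * ∫ x, χ x := by
    intro η hη
    set f : 𝔼 → ℝ := fun x => χ x * (w x / √(η + w x ^ 2)) with hf
    have hpos : ∀ x, 0 < √(η + w x ^ 2) := fun x => Real.sqrt_pos.2 (by positivity)
    have hq : ContDiff ℝ 1 fun x => w x / √(η + w x ^ 2) :=
      hwC.div (ContDiff.sqrt (contDiff_const.add (hwC.pow 2)) fun x => by positivity)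
        fun x => (hpos x).ne'
    have hfC : ContDiff ℝ 1 f := hχ.mul hq
    have hfs : Function.support f ⊆ Function.support χ := fun x hx hx' => hx (by simp [f, hx'])
    set g : 𝔼 → 𝔼 := fun x => -(f x • e) with hg
    have hgC : ContDiff ℝ 1 g := (hfC.smul contDiff_const).neg
    have hgs : Function.support g ⊆ Function.support χ := fun x hx hx' => hx (by simp [g, f, hx'])
    have hgc : HasCompactSupport g := hc.mono hgs
    have hgts : tsupport g ⊆ tsupport χ := closure_mono hgs
    have hg1 : ∀ x, ‖g x‖ ≤ 1 := by
      intro x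
      rw [norm_neg, norm_smul, he, mul_one, hf, norm_mul, Real.norm_of_nonneg (hr x).1]
      refine mul_le_one₀ (hr x).2 (norm_nonneg _) ?_
      rw [norm_div, Real.norm_of_nonneg (hpos x).le, Real.norm_eq_abs]
      exact div_le_one_of_le₀ (Real.abs_le_sqrt (by linarith)) (hpos x).le
    have hgt : IsTest Ω (mollify φ g) :=
      isTest_mollify φ hgC hgc ((add_subset_add_left hgts).trans hs)
    have h1 := integral_mul_div_le_totalVariation hu hgt
      (norm_mollify_le φ hgC.continuous.aestronglyMeasurable hg1)
    rw [← integral_mollify_indicator_mul_div φ hΩ.measurableSet hu.1 hgC hgc,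
      integral_mul_div_eq hW hgC hgc, ← integral_neg] at h1
    have h2 : ∀ x, -(fderiv ℝ W x (g x)) = f x * w x := fun x => by simp [g, hw]
    simp_rw [h2] at h1
    have hifw : Integrable fun x => f x * w x :=
      (hfC.continuous.mul hwC.continuous).integrable_of_hasCompactSupport (hc.mono hfs).mul_right
    have h3 : (∫ x, χ x * |w x|) ≤ ∫ x, (f x * w x + √η * χ x) := by
      refine integral_mono hi (hifw.add (hiχ.const_mul _)) fun x => ?_
      have := mul_le_mul_of_nonneg_left (abs_sub_sqrt_le (t := w x) hη) (hr x).1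
      have h4 : f x * w x = χ x * (w x ^ 2 / √(η + w x ^ 2)) := by simp only [hf]; ring
      simp only [h4]
      linarith
    rw [integral_add hifw (hiχ.const_mul _), integral_const_mul] at h3
    linarith
  have hlim : Tendsto (fun η : ℝ => (totalVariation Ω u).toReal + √η * ∫ x, χ x) (𝓝[>] 0)
      (𝓝 ((totalVariation Ω u).toReal)) := by
    have : Tendsto (fun η : ℝ => (totalVariation Ω u).toReal + √η * ∫ x, χ x) (𝓝 0)
        (𝓝 ((totalVariation Ω u).toReal + √0 * ∫ x, χ x)) :=
      (Continuous.tendsto (by fun_prop) 0)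
    simp only [Real.sqrt_zero, zero_mul, add_zero] at this
    exact this.mono_left nhdsWithin_le_nhds
  exact ge_of_tendsto hlim (eventually_mem_nhdsWithin.mono fun η hη => key η hη)

/-- Only the threshold for `k` depends on `K`, not the bound; this lets `K` later approach the
boundary. -/
lemma eventually_lintegral_fderiv_mollify_le (hΩ : IsOpen Ω) (hu : MemBV Ω u) {e : 𝔼}
    (he : ‖e‖ = 1) {K : Set 𝔼} (hK : IsCompact K) (hKΩ : K ⊆ Ω) :
    ∀ᶠ k in atTop, ∫⁻ x in K, ‖fderiv ℝ (mollify (bump n k) (Ω.indicator u)) x e‖ₑ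
      ≤ totalVariation Ω u := by
  obtain ⟨χ, hχ, hr, h1⟩ := exists_cutoff hK hΩ hKΩ
  filter_upwards [eventually_closedBall_bump_add_subset hχ.2.1.isCompact hΩ hχ.2.2] with k hk
  have hui : Integrable (Ω.indicator u) := (integrable_indicator_iff hΩ.measurableSet).2 hu.1
  have hW : ContDiff ℝ 1 (mollify (bump n k) (Ω.indicator u)) :=
    contDiff_mollify _ hui.locallyIntegrable
  have hcont : Continuous fun x => fderiv ℝ (mollify (bump n k) (Ω.indicator u)) x e := by
    have := hW.continuous_fderiv one_ne_zero
    fun_prop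
  have hi : Integrable fun x => χ x * |fderiv ℝ (mollify (bump n k) (Ω.indicator u)) x e| :=
    (hχ.1.continuous.mul hcont.abs).integrable_of_hasCompactSupport hχ.2.1.mul_right
  calc ∫⁻ x in K, ‖fderiv ℝ (mollify (bump n k) (Ω.indicator u)) x e‖ₑ
      = ∫⁻ x in K,
          ENNReal.ofReal (χ x * |fderiv ℝ (mollify (bump n k) (Ω.indicator u)) x e|) := by
        refine setLIntegral_congr_fun hK.measurableSet fun x hx => ?_
        simp only [h1 x hx, one_mul]
        rw [Real.enorm_eq_ofReal_abs]
    _ ≤ ∫⁻ x, ENNReal.ofReal (χ x * |fderiv ℝ (mollify (bump n k) (Ω.indicator u)) x e|) :=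
        setLIntegral_le_lintegral _ _
    _ = ENNReal.ofReal (∫ x, χ x * |fderiv ℝ (mollify (bump n k) (Ω.indicator u)) x e|) :=
        (ofReal_integral_eq_lintegral_ofReal hi (Eventually.of_forall fun x =>
          mul_nonneg (hr x).1 (abs_nonneg _))).symm
    _ ≤ totalVariation Ω u := by
        rw [← ENNReal.ofReal_toReal hu.2.ne]
        exact ENNReal.ofReal_le_ofReal
          (integral_cutoff_mul_abs_fderiv_le hΩ hu _ he hχ.1 hχ.2.1 hk hr)

end DerivativeBound

/-! ### One-dimensional traces and Lebesgue points -/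

section Slices

/-- The dyadic interval `(ρ 2^{-(j+1)}, ρ 2^{-j}]`. -/
def dyadicIoc (ρ : ℝ) (j : ℕ) : Set ℝ := Ioc (ρ / 2 ^ (j + 1)) (ρ / 2 ^ j)

/-- The union of two successive dyadic intervals. -/
def dyadicPair (ρ : ℝ) (j : ℕ) : Set ℝ := Ioc (ρ / 2 ^ (j + 2)) (ρ / 2 ^ j)

variable {ρ : ℝ}

lemma div_two_pow_anti (hρ : 0 < ρ) {i j : ℕ} (h : i ≤ j) : ρ / 2 ^ j ≤ ρ / 2 ^ i := by
  gcongr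
  norm_num

lemma dyadicIoc_subset_pair (hρ : 0 < ρ) (j : ℕ) : dyadicIoc ρ j ⊆ dyadicPair ρ j :=
  Ioc_subset_Ioc_left (div_two_pow_anti hρ (by omega))

lemma dyadicIoc_succ_subset_pair (hρ : 0 < ρ) (j : ℕ) : dyadicIoc ρ (j + 1) ⊆ dyadicPair ρ j :=
  Ioc_subset_Ioc_right (div_two_pow_anti hρ (by omega))

lemma dyadicIoc_subset (hρ : 0 < ρ) (j : ℕ) : dyadicIoc ρ j ⊆ Ioc 0 ρ :=
  Ioc_subset_Ioc (by positivity) (by simpa using div_two_pow_anti hρ (Nat.zero_le j))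

lemma Ioc_subset_iUnion_dyadicIoc (hρ : 0 < ρ) (m : ℕ) :
    Ioc 0 (ρ / 2 ^ m) ⊆ ⋃ i, dyadicIoc ρ (i + m) := by
  intro t ht
  have hpos : 0 < ρ / 2 ^ m := by positivity
  obtain ⟨i, hi1, hi2⟩ := exists_nat_pow_near_of_lt_one (x := t / (ρ / 2 ^ m)) (y := (1 / 2 : ℝ))
    (div_pos ht.1 hpos) ((div_le_one hpos).2 ht.2) (by norm_num) (by norm_num)
  rw [lt_div_iff₀ hpos] at hi1
  rw [div_le_iff₀ hpos] at hi2
  refine mem_iUnion.2 ⟨i, ?_, ?_⟩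
  · convert hi1 using 1
    rw [show i + m + 1 = (i + 1) + m by ring, pow_add, div_pow, one_pow]
    field_simp
  · convert hi2 using 1
    rw [pow_add, div_pow, one_pow]
    field_simp

instance isFiniteMeasure_restrict_dyadicIoc (j : ℕ) :
    IsFiniteMeasure (volume.restrict (dyadicIoc ρ j)) :=
  ⟨by simp [dyadicIoc]⟩

lemma restrict_dyadicIoc_ne_zero (hρ : 0 < ρ) (j : ℕ) :
    NeZero (volume.restrict (dyadicIoc ρ j)) := by
  refine ⟨?_⟩
  rw [Ne, Measure.restrict_eq_zero, dyadicIoc, Real.volume_Ioc]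
  simp only [ENNReal.ofReal_eq_zero, not_le, sub_pos]
  gcongr
  · norm_num
  · omega

lemma abs_sub_average_le {μ : Measure ℝ} [IsFiniteMeasure μ] [NeZero μ] {w : ℝ → ℝ}
    (hw : Integrable w μ) {c V : ℝ} (h : ∀ᵐ s ∂μ, |w s - c| ≤ V) : |⨍ s, w s ∂μ - c| ≤ V := by
  have := (convex_closedBall c V).average_mem Metric.isClosed_closedBall
    (by simpa [Real.dist_eq] using h) hw
  simpa [Real.dist_eq] using this

/-- One-dimensional trace at `0` for a function with summable oscillations on dyadic intervals. -/
lemma exists_limit_of_oscillation (hρ : 0 < ρ) {w : ℝ → ℝ} (hw : IntegrableOn w (Ioc 0 ρ))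
    {V : ℕ → ℝ≥0∞} (hV : ∑' j, V j ≠ ∞)
    (h : ∀ j, ∀ᵐ t ∂volume.restrict (dyadicPair ρ j), ∀ᵐ s ∂volume.restrict (dyadicPair ρ j),
      ‖w t - w s‖ₑ ≤ V j) :
    ∃ τ : ℝ, Tendsto (fun j => ⨍ t in dyadicIoc ρ j, w t) atTop (𝓝 τ) ∧
      (∀ m, |(⨍ t in dyadicIoc ρ m, w t) - τ| ≤ (∑' i, V (i + m)).toReal) ∧
      ∀ m, ∀ᵐ t ∂volume.restrict (Ioc 0 (ρ / 2 ^ m)),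
        |w t - τ| ≤ 2 * (∑' i, V (i + m)).toReal := by
  have hVj : ∀ j, V j ≠ ∞ := ENNReal.ne_top_of_tsum_ne_top hV
  have hVm : ∀ m, ∑' i, V (i + m) ≠ ∞ := fun m =>
    ne_top_of_le_ne_top hV (ENNReal.tsum_comp_le_tsum_of_injective (add_left_injective m) V)
  set a : ℕ → ℝ := fun j => ⨍ t in dyadicIoc ρ j, w t with ha
  set T : ℕ → ℝ := fun m => (∑' i, V (i + m)).toReal with hT
  have hwj : ∀ j, Integrable w (volume.restrict (dyadicIoc ρ j)) := fun j =>
    hw.mono_set (dyadicIoc_subset hρ j)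
  have hreal : ∀ j {x y : ℝ}, ‖x - y‖ₑ ≤ V j → |y - x| ≤ (V j).toReal := by
    intro j x y hxy
    rw [Real.enorm_eq_ofReal_abs, ENNReal.ofReal_le_iff_le_toReal (hVj j), abs_sub_comm] at hxy
    exact hxy
  have havg : ∀ i j, dyadicIoc ρ i ⊆ dyadicPair ρ j →
      ∀ᵐ t ∂volume.restrict (dyadicPair ρ j), |w t - a i| ≤ (V j).toReal := by
    intro i j hij
    filter_upwards [h j] with t ht
    have := restrict_dyadicIoc_ne_zero hρ i
    rw [abs_sub_comm]
    refine abs_sub_average_le (hwj i) ?_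
    filter_upwards [ae_restrict_of_ae_restrict_of_subset hij ht] with s hs
    exact hreal j hs
  -- Intervals `j` and `j + 1` both lie in `dyadicPair ρ j`, so `V j` controls the difference of
  -- their averages; this is why oscillation is measured on pairs.
  have hstep : ∀ j, dist (a j) (a (j + 1)) ≤ (V j).toReal := by
    intro j
    have := restrict_dyadicIoc_ne_zero hρ j
    rw [Real.dist_eq]
    refine abs_sub_average_le (hwj j) ?_
    exact ae_restrict_of_ae_restrict_of_subset (dyadicIoc_subset_pair hρ j)
      (havg (j + 1) j (dyadicIoc_succ_subset_pair hρ j))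
  have hsum : Summable fun j => (V j).toReal := ENNReal.summable_toReal hV
  obtain ⟨τ, hτ⟩ := cauchySeq_tendsto_of_complete (cauchySeq_of_dist_le_of_summable _ hstep hsum)
  have hTeq : ∀ m, ∑' i, (V (m + i)).toReal = T m := by
    intro m
    simp only [hT]
    rw [ENNReal.tsum_toReal_eq fun i => hVj _]
    simp_rw [add_comm m]
  have haτ : ∀ m, |a m - τ| ≤ T m := by
    intro m
    rw [← hTeq, ← Real.dist_eq]
    exact dist_le_tsum_of_dist_le_of_tendsto _ hstep hsum hτ m
  refine ⟨τ, hτ, haτ, fun m => ?_⟩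
  refine ae_restrict_of_ae_restrict_of_subset (Ioc_subset_iUnion_dyadicIoc hρ m) ?_
  rw [ae_restrict_iUnion_iff]
  intro i
  have h1 := ae_restrict_of_ae_restrict_of_subset (dyadicIoc_subset_pair hρ (i + m))
    (havg (i + m) (i + m) (dyadicIoc_subset_pair hρ (i + m)))
  filter_upwards [h1] with t ht
  have hVT : (V (i + m)).toReal ≤ T m := by
    refine ENNReal.toReal_mono (hVm m) ?_
    exact ENNReal.le_tsum (f := fun i => V (i + m)) i
  have hTT : T (i + m) ≤ T m := by
    refine ENNReal.toReal_mono (hVm m) ?_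
    have := ENNReal.tsum_comp_le_tsum_of_injective (add_left_injective i) fun k => V (k + m)
    simpa [add_assoc] using this
  calc |w t - τ| ≤ |w t - a (i + m)| + |a (i + m) - τ| := abs_sub_le _ _ _
    _ ≤ 2 * T m := by linarith [haτ (i + m)]

variable {F : Type*} [NormedAddCommGroup F] [InnerProductSpace ℝ F] [FiniteDimensional ℝ F]
  [MeasurableSpace F] [BorelSpace F]

lemma ae_tendsto_average_closedBall {f : F → ℝ} (hf : LocallyIntegrable f) :
    ∀ᵐ x, Tendsto (fun r : ℝ => ⨍ y in Metric.closedBall x r, |f y - f x|) (𝓝[>] 0) (𝓝 0) := by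
  filter_upwards [IsUnifLocDoublingMeasure.ae_tendsto_average_norm_sub volume hf 1] with x hx
  refine hx (fun _ => x) id tendsto_id ?_
  filter_upwards [self_mem_nhdsWithin] with r hr
  simpa using le_of_lt hr

/-- The mean deviation of `w` from `τ x` on small cylinders based at a Lebesgue point `x`. -/
lemma tendsto_cylinder_of_lebesguePoint (hρ : 0 < ρ) {D : Set F} {x : F} (hx : x ∈ interior D)
    {w : F × ℝ → ℝ} (hw : IntegrableOn w (D ×ˢ Ioc 0 ρ)) {τ : F → ℝ}
    {T : ℕ → F → ℝ} (hτi : IntegrableOn τ D) (hTi : ∀ m, IntegrableOn (T m) D)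
    (hT0 : Tendsto (fun m => T m x) atTop (𝓝 0))
    (hbound : ∀ᵐ y ∂volume.restrict D, ∀ m, ∀ᵐ t ∂volume.restrict (Ioc 0 (ρ / 2 ^ m)),
      |w (y, t) - τ y| ≤ 2 * T m y)
    (hτL : Tendsto (fun r : ℝ => ⨍ y in Metric.closedBall x r,
      |D.indicator τ y - D.indicator τ x|) (𝓝[>] 0) (𝓝 0))
    (hTL : ∀ m, Tendsto (fun r : ℝ => ⨍ y in Metric.closedBall x r,
      |D.indicator (T m) y - D.indicator (T m) x|) (𝓝[>] 0) (𝓝 0))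
    {L : ℝ} (hL : 0 < L) :
    Tendsto (fun r : ℝ => (r ^ (Module.finrank ℝ F + 1))⁻¹ *
      ∫ p in Metric.closedBall x r ×ˢ Ioc 0 (L * r), |w p - τ x|) (𝓝[>] 0) (𝓝 0) := by
  have hxD : x ∈ D := interior_subset hx
  set c : ℝ := volume.real (Metric.ball (0 : F) 1) with hc
  have hc0 : 0 ≤ c := measureReal_nonneg
  -- Once `L r ≤ ρ / 2 ^ m`, `|w (y, t) - τ x| ≤ 2 T_m(y) + |τ y - τ x|` on the cylinder, and
  -- `T_m(y) ≤ |T_m(y) - T_m(x)| + T_m(x)`. The factor `L * c` is the cylinder's volume divided by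
  -- the power of `r`.
  have main : ∀ m, ∀ᶠ r in 𝓝[>] (0 : ℝ), (r ^ (Module.finrank ℝ F + 1))⁻¹ *
      (∫ p in Metric.closedBall x r ×ˢ Ioc 0 (L * r), |w p - τ x|)
      ≤ L * c * (2 * (⨍ y in Metric.closedBall x r, |D.indicator (T m) y - D.indicator (T m) x|)
        + 2 * T m x + ⨍ y in Metric.closedBall x r, |D.indicator τ y - D.indicator τ x|) := by
    intro m
    obtain ⟨ε, hε, hεD⟩ := Metric.mem_nhds_iff.1 (mem_interior_iff_mem_nhds.1 hx)
    have h1 : ∀ᶠ r in 𝓝[>] (0 : ℝ), r < ε := nhdsWithin_le_nhds (Iio_mem_nhds hε)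
    have h2 : ∀ᶠ r in 𝓝[>] (0 : ℝ), r < ρ / 2 ^ m / L :=
      nhdsWithin_le_nhds (Iio_mem_nhds (by positivity))
    filter_upwards [h1, h2, self_mem_nhdsWithin] with r hr1 hr2 (hr : 0 < r)
    have hrm : L * r ≤ ρ / 2 ^ m := by
      rw [lt_div_iff₀ hL] at hr2; linarith
    have hrρ : L * r ≤ ρ := hrm.trans (by simpa using div_two_pow_anti hρ (Nat.zero_le m))
    set B := Metric.closedBall x r with hB
    have hBD : B ⊆ D := (Metric.closedBall_subset_ball hr1).trans hεD
    have hBm : MeasurableSet B := Metric.isClosed_closedBall.measurableSet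
    have hBfin : volume B ≠ ∞ := measure_closedBall_lt_top.ne
    have hBvol : volume.real B = r ^ Module.finrank ℝ F * c := by
      rw [hB, hc, Measure.addHaar_real_closedBall _ _ hr.le]
    have hLr : 0 ≤ L * r := by positivity
    have hcyl : IntegrableOn (fun p => |w p - τ x|) (B ×ˢ Ioc 0 (L * r)) := by
      have h3 : IntegrableOn w (B ×ˢ Ioc 0 (L * r)) :=
        hw.mono_set (prod_mono hBD (Ioc_subset_Ioc_right hrρ))
      have h4 : IntegrableOn (fun _ : F × ℝ => τ x) (B ×ˢ Ioc 0 (L * r)) := by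
        refine integrableOn_const ?_
        rw [Measure.volume_eq_prod, Measure.prod_prod]
        exact ENNReal.mul_ne_top hBfin (by simp)
      exact (h3.sub h4).abs
    have hTB := (hTi m).mono_set hBD
    have hτB := hτi.mono_set hBD
    have hcB : ∀ a : ℝ, IntegrableOn (fun _ : F => a) B := fun a => integrableOn_const hBfin
    have hdT : IntegrableOn (fun y => |T m y - T m x|) B := (hTB.sub (hcB _)).abs
    have hdτ : IntegrableOn (fun y => |τ y - τ x|) B := (hτB.sub (hcB _)).abs
    have hsum1 : IntegrableOn (fun y => 2 * |T m y - T m x| + 2 * T m x) B :=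
      (hdT.const_mul 2).add (hcB _)
    have hsum : IntegrableOn
        (fun y => 2 * |T m y - T m x| + 2 * T m x + |τ y - τ x|) B := hsum1.add hdτ
    have hcyl' : Integrable (fun p => |w p - τ x|)
        ((volume.restrict B).prod (volume.restrict (Ioc 0 (L * r)))) := by
      rw [Measure.prod_restrict, ← Measure.volume_eq_prod]; exact hcyl
    have hfub : ∫ p in B ×ˢ Ioc 0 (L * r), |w p - τ x|
        = ∫ y in B, ∫ t in Ioc 0 (L * r), |w (y, t) - τ x| := by
      rw [Measure.volume_eq_prod, ← Measure.prod_restrict, integral_prod _ hcyl']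
    have hint : ∫ p in B ×ˢ Ioc 0 (L * r), |w p - τ x|
        ≤ ∫ y in B, (L * r) * (2 * |T m y - T m x| + 2 * T m x + |τ y - τ x|) := by
      rw [hfub]
      refine integral_mono_ae hcyl'.integral_prod_left (hsum.const_mul _) ?_
      filter_upwards [ae_restrict_of_ae_restrict_of_subset hBD hbound, hcyl'.prod_right_ae]
        with y hy hyi
      calc ∫ t in Ioc 0 (L * r), |w (y, t) - τ x|
          ≤ ∫ t in Ioc 0 (L * r), (2 * |T m y - T m x| + 2 * T m x + |τ y - τ x|) := by
            refine integral_mono_ae hyi (integrableOn_const (by simp)) ?_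
            filter_upwards [ae_restrict_of_ae_restrict_of_subset
              (Ioc_subset_Ioc_right hrm) (hy m)] with t ht
            have h5 := abs_sub_le (w (y, t)) (τ y) (τ x)
            have h6 := le_abs_self (T m y - T m x)
            linarith
        _ = (L * r) * (2 * |T m y - T m x| + 2 * T m x + |τ y - τ x|) := by
            rw [setIntegral_const]
            simp [Measure.real, ENNReal.toReal_ofReal hLr]
    have hconv : ∀ f : F → ℝ, ∫ y in B, |f y - f x|
        = volume.real B * ⨍ y in B, |D.indicator f y - D.indicator f x| := by
      intro f
      rw [← smul_eq_mul, measure_smul_setAverage _ hBfin]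
      refine setIntegral_congr_fun hBm fun y hy => ?_
      simp only [indicator_of_mem (hBD hy), indicator_of_mem hxD]
    have heq : ∫ y in B, (L * r) * (2 * |T m y - T m x| + 2 * T m x + |τ y - τ x|)
        = (L * r) * (volume.real B *
          (2 * (⨍ y in B, |D.indicator (T m) y - D.indicator (T m) x|)
          + 2 * T m x + ⨍ y in B, |D.indicator τ y - D.indicator τ x|)) := by
      rw [integral_const_mul, integral_add hsum1 hdτ, integral_add (hdT.const_mul 2) (hcB _),
        integral_const_mul, hconv, hconv, setIntegral_const, smul_eq_mul]
      ring
    have hrd : 0 < r ^ (Module.finrank ℝ F + 1) := by positivity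
    calc (r ^ (Module.finrank ℝ F + 1))⁻¹ * (∫ p in B ×ˢ Ioc 0 (L * r), |w p - τ x|)
        ≤ (r ^ (Module.finrank ℝ F + 1))⁻¹ * ((L * r) * (volume.real B *
          (2 * (⨍ y in B, |D.indicator (T m) y - D.indicator (T m) x|)
          + 2 * T m x + ⨍ y in B, |D.indicator τ y - D.indicator τ x|))) := by
          rw [← heq]
          gcongr
      _ = _ := by
          rw [hBvol, pow_succ]
          field_simp
  -- First `m` is fixed so that the tail `T m x` is small, then `r` is sent to `0`; the Lebesgue
  -- property is needed for each `T m` separately.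
  rw [Metric.tendsto_nhds]
  intro ε hε
  have hlim0 : Tendsto (fun m => L * c * (2 * 0 + 2 * T m x + 0)) atTop (𝓝 0) := by
    simpa using (hT0.const_mul 2).const_mul (L * c)
  obtain ⟨m, hm⟩ := ((tendsto_order.1 hlim0).2 ε hε).exists
  have hlim := ((((hTL m).const_mul 2).add_const (2 * T m x)).add hτL).const_mul (L * c)
  filter_upwards [main m, (tendsto_order.1 hlim).2 ε hm, self_mem_nhdsWithin]
    with r hr1 hr2 (hr : 0 < r)
  rw [Real.dist_eq, sub_zero, abs_of_nonneg]
  · exact hr1.trans_lt hr2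
  · exact mul_nonneg (by positivity) (integral_nonneg fun p => abs_nonneg _)

/-- Existence of a trace on `D × {0}` for a function on `D × (0, ρ]` whose oscillations along the
vertical dyadic intervals are summable. -/
theorem exists_trace_of_oscillation (hρ : 0 < ρ) {D : Set F} (hD : MeasurableSet D)
    {w : F × ℝ → ℝ} (hw : IntegrableOn w (D ×ˢ Ioc 0 ρ)) {V : ℕ → F → ℝ≥0∞}
    (hVm : ∀ j, Measurable (V j)) (hV : ∑' j, ∫⁻ y in D, V j y ≠ ∞)
    (h : ∀ᵐ y ∂volume.restrict D, ∀ j, ∀ᵐ t ∂volume.restrict (dyadicPair ρ j),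
      ∀ᵐ s ∂volume.restrict (dyadicPair ρ j), ‖w (y, t) - w (y, s)‖ₑ ≤ V j y) :
    ∃ τ : F → ℝ, StronglyMeasurable τ ∧ IntegrableOn τ D ∧
      ∀ᵐ x ∂volume.restrict (interior D), ∀ L > 0,
      Tendsto (fun r : ℝ => (r ^ (Module.finrank ℝ F + 1))⁻¹ *
        ∫ p in Metric.closedBall x r ×ˢ Ioc 0 (L * r), |w p - τ x|) (𝓝[>] 0) (𝓝 0) := by
  have hw' : Integrable w ((volume.restrict D).prod (volume.restrict (Ioc 0 ρ))) := by
    rw [Measure.prod_restrict, ← Measure.volume_eq_prod]; exact hw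
  have hVsum : ∫⁻ y in D, ∑' j, V j y ≠ ∞ := by
    rwa [lintegral_tsum fun j => (hVm j).aemeasurable]
  have hVfin : ∀ᵐ y ∂volume.restrict D, ∑' j, V j y ≠ ∞ :=
    (ae_lt_top' (Measurable.tsum hVm).aemeasurable hVsum).mono fun y hy => hy.ne
  set a : ℕ → F → ℝ := fun j y => ⨍ t in dyadicIoc ρ j, w (y, t) with ha
  have hwj : ∀ j, Integrable w ((volume.restrict D).prod (volume.restrict (dyadicIoc ρ j))) := by
    intro j
    rw [Measure.prod_restrict, ← Measure.volume_eq_prod]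
    exact hw.mono_set (prod_mono le_rfl (dyadicIoc_subset hρ j))
  have hai : ∀ j, IntegrableOn (a j) D := by
    intro j
    simp only [ha, average_eq]
    exact (hwj j).integral_prod_left.const_mul _
  set T : ℕ → F → ℝ := fun m y => (∑' i, V (i + m) y).toReal with hTdef
  have hlim : ∀ᵐ y ∂volume.restrict D, ∃ τ : ℝ,
      Tendsto (fun j => a j y) atTop (𝓝 τ) ∧ (∀ m, |a m y - τ| ≤ T m y) ∧
      ∀ m, ∀ᵐ t ∂volume.restrict (Ioc 0 (ρ / 2 ^ m)), |w (y, t) - τ| ≤ 2 * T m y := by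
    filter_upwards [h, hVfin, hw'.prod_right_ae] with y hy hVy hwy
    exact exists_limit_of_oscillation hρ hwy hVy hy
  -- The linewise limits come from separate existence statements; as limits of the measurable
  -- averages `a j` they have a measurable version.
  obtain ⟨τ, hτm, hτ⟩ := exists_stronglyMeasurable_limit_of_tendsto_ae
    (fun j => (hai j).aestronglyMeasurable) (hlim.mono fun y hy => ⟨hy.choose, hy.choose_spec.1⟩)
  have hτ2 : ∀ᵐ y ∂volume.restrict D, |a 0 y - τ y| ≤ T 0 y ∧
      ∀ m, ∀ᵐ t ∂volume.restrict (Ioc 0 (ρ / 2 ^ m)), |w (y, t) - τ y| ≤ 2 * T m y := by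
    filter_upwards [hlim, hτ] with y hy hτy
    obtain ⟨τ', h1, h2, h3⟩ := hy
    obtain rfl := tendsto_nhds_unique h1 hτy
    exact ⟨h2 0, h3⟩
  have hTi : ∀ m, IntegrableOn (T m) D := by
    intro m
    refine integrable_toReal_of_lintegral_ne_top
      (Measurable.tsum fun i => hVm (i + m)).aemeasurable ?_
    refine ne_top_of_le_ne_top hVsum (lintegral_mono fun y => ?_)
    exact ENNReal.tsum_comp_le_tsum_of_injective (add_left_injective m) fun i => V i y
  have hτi : IntegrableOn τ D := by
    refine Integrable.mono' ((hai 0).abs.add (hTi 0)) hτm.aestronglyMeasurable ?_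
    filter_upwards [hτ2] with y hy
    have := abs_sub_abs_le_abs_sub (τ y) (a 0 y)
    rw [abs_sub_comm] at this
    simp only [Pi.add_apply, Real.norm_eq_abs]
    linarith [hy.1]
  have hind : ∀ {f : F → ℝ}, IntegrableOn f D → LocallyIntegrable (D.indicator f) :=
    fun hf => ((integrable_indicator_iff hD).2 hf).locallyIntegrable
  refine ⟨τ, hτm, hτi, ?_⟩
  have hleb : ∀ᵐ x, ∀ m, Tendsto (fun r : ℝ => ⨍ y in Metric.closedBall x r,
      |D.indicator (T m) y - D.indicator (T m) x|) (𝓝[>] 0) (𝓝 0) :=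
    ae_all_iff.2 fun m => ae_tendsto_average_closedBall (hind (hTi m))
  filter_upwards [ae_restrict_of_ae hleb,
    ae_restrict_of_ae (ae_tendsto_average_closedBall (hind hτi)),
    ae_restrict_of_ae_restrict_of_subset interior_subset hVfin,
    ae_restrict_mem isOpen_interior.measurableSet] with x hx1 hx2 hx3 hx4 L hL
  have hT0 : Tendsto (fun m => T m x) atTop (𝓝 0) := by
    have := (ENNReal.continuousAt_toReal ENNReal.zero_ne_top).tendsto.comp
      (ENNReal.tendsto_sum_nat_add (fun j => V j x) hx3)
    simpa [Function.comp_def, hTdef] using this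
  exact tendsto_cylinder_of_lebesguePoint hρ hx4 hw hτi hTi hT0 (hτ2.mono fun y hy => hy.2)
    hx2 hx1 hL

end Slices

/-! ### Coordinates above a Lipschitz graph and vertical oscillation -/

section Graph

variable {n : ℕ}

local notation "𝔼" => EuclideanSpace ℝ (Fin n)

variable {Ω : Set (EuclideanSpace ℝ (Fin n))} {u : EuclideanSpace ℝ (Fin n) → ℝ}
  {e : EuclideanSpace ℝ (Fin n)} {γ : EuclideanSpace ℝ (Fin n) → ℝ}

/-- The coordinates above the graph of `γ` in direction `e`. -/
noncomputable def graphMap (e : EuclideanSpace ℝ (Fin n)) (γ : EuclideanSpace ℝ (Fin n) → ℝ)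
    (p : (Submodule.span ℝ {e})ᗮ × ℝ) : EuclideanSpace ℝ (Fin n) :=
  (p.1 : EuclideanSpace ℝ (Fin n)) + (γ p.1 + p.2) • e

/-- The orthogonal projection to the hyperplane orthogonal to `e`. -/
noncomputable def hproj (e : EuclideanSpace ℝ (Fin n)) :
    EuclideanSpace ℝ (Fin n) →L[ℝ] (Submodule.span ℝ {e})ᗮ :=
  (Submodule.span ℝ {e})ᗮ.orthogonalProjectionOnto

lemma coe_hproj (he : ‖e‖ = 1) (x : 𝔼) : (hproj e x : 𝔼) = x - inner ℝ e x • e := by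
  rw [hproj, Submodule.orthogonalProjectionOnto_orthogonal]
  simp [Submodule.starProjection_unit_singleton ℝ he]

lemma norm_hproj_sub_le (x y : 𝔼) : ‖hproj e x - hproj e y‖ ≤ ‖x - y‖ := by
  rw [← map_sub]
  exact Submodule.norm_orthogonalProjectionOnto_apply_le _ _

lemma inner_coe_orthogonal (y : (Submodule.span ℝ {e})ᗮ) : inner ℝ e (y : 𝔼) = 0 :=
  Submodule.mem_orthogonal_singleton_iff_inner_right.1 y.2

lemma inner_graphMap (he : ‖e‖ = 1) (p : (Submodule.span ℝ {e})ᗮ × ℝ) :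
    inner ℝ e (graphMap e γ p) = γ p.1 + p.2 := by
  rw [graphMap, inner_add_right, inner_coe_orthogonal, inner_smul_right,
    real_inner_self_eq_norm_sq, he]
  ring

lemma graphMap_sub_inner (he : ‖e‖ = 1) (p : (Submodule.span ℝ {e})ᗮ × ℝ) :
    graphMap e γ p - inner ℝ e (graphMap e γ p) • e = p.1 := by
  rw [inner_graphMap he, graphMap, add_sub_cancel_right]

lemma hproj_graphMap (he : ‖e‖ = 1) (p : (Submodule.span ℝ {e})ᗮ × ℝ) :
    hproj e (graphMap e γ p) = p.1 :=
  Subtype.ext (by rw [coe_hproj he, graphMap_sub_inner he])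

lemma graphMap_hproj (he : ‖e‖ = 1) (x : 𝔼) :
    graphMap e γ (hproj e x, inner ℝ e x - γ (hproj e x)) = x := by
  simp [graphMap, coe_hproj he]

lemma graphMap_injective (he : ‖e‖ = 1) : Function.Injective (graphMap e γ) := by
  intro p q h
  have h1 : p.1 = q.1 := by rw [← hproj_graphMap (γ := γ) he p, h, hproj_graphMap he]
  have h2 : γ p.1 + p.2 = γ q.1 + q.2 := by
    rw [← inner_graphMap he, h, inner_graphMap he]
  refine Prod.ext h1 ?_
  rw [h1] at h2
  exact add_left_cancel h2

lemma continuous_graphMap (hγ : Continuous γ) : Continuous (graphMap e γ) := by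
  unfold graphMap
  fun_prop

lemma measurableEmbedding_graphMap (he : ‖e‖ = 1) (hγ : Continuous γ) :
    MeasurableEmbedding (graphMap e γ) :=
  (continuous_graphMap hγ).measurableEmbedding (graphMap_injective he)

/-- A vertical shear followed by the orthogonal splitting along `e`. The shear translates each
vertical line, so continuity of `γ` suffices. -/
lemma measurePreserving_graphMap (he : ‖e‖ = 1) (hγ : Continuous γ) :
    MeasurePreserving (graphMap e γ) := by
  have hshear : MeasurePreserving
      (fun p : (Submodule.span ℝ {e})ᗮ × ℝ => (p.1, γ p.1 + p.2)) := by
    refine (MeasurePreserving.id volume).skew_product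
      (g := fun (y : (Submodule.span ℝ {e})ᗮ) (t : ℝ) => γ y + t) ?_
      (Eventually.of_forall fun y => (measurePreserving_add_left volume (γ y)).map_eq)
    exact Continuous.measurable (by fun_prop)
  have hswap : MeasurePreserving
      (Prod.swap : (Submodule.span ℝ {e})ᗮ × ℝ → ℝ × (Submodule.span ℝ {e})ᗮ) :=
    Measure.measurePreserving_swap
  have hline : MeasurePreserving (Prod.map (LinearIsometryEquiv.toSpanUnitSingleton (𝕜 := ℝ) e he)
      (id : (Submodule.span ℝ {e})ᗮ → (Submodule.span ℝ {e})ᗮ)) :=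
    (LinearIsometryEquiv.measurePreserving _).prod (MeasurePreserving.id volume)
  have hsum := ((Submodule.span ℝ {e}).measurePreserving_measurableEquivProd (0 : 𝔼)).symm
  rw [InnerProductSpace.euclideanHausdorffMeasure_eq_volume] at hsum
  have := hsum.comp (hline.comp (hswap.comp hshear))
  convert this using 1
  ext1 p
  simp [graphMap, add_comm]

lemma sum_lintegral_dyadicIoc {ρ : ℝ} (hρ : 0 < ρ) (f : ℝ → ℝ≥0∞) (N : ℕ) :
    ∑ j ∈ Finset.range N, ∫⁻ t in dyadicIoc ρ j, f t = ∫⁻ t in Ioc (ρ / 2 ^ N) ρ, f t := by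
  induction N with
  | zero => simp
  | succ N ih =>
    rw [Finset.sum_range_succ, ih, add_comm, dyadicIoc, ← lintegral_union measurableSet_Ioc,
      Ioc_union_Ioc_eq_Ioc (div_two_pow_anti hρ (Nat.le_succ N))]
    · simpa using div_two_pow_anti hρ (Nat.zero_le N)
    · exact Ioc_disjoint_Ioc_of_le le_rfl

/-- Each point lies in at most two of the overlapping pairs, hence the factor `2`. -/
lemma sum_lintegral_dyadicPair_le {ρ : ℝ} (hρ : 0 < ρ) (f : ℝ → ℝ≥0∞) (N : ℕ) :
    ∑ j ∈ Finset.range N, ∫⁻ t in dyadicPair ρ j, f t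
      ≤ 2 * ∫⁻ t in Ioc (ρ / 2 ^ (N + 1)) ρ, f t := by
  have h1 : ∀ j, ∫⁻ t in dyadicPair ρ j, f t
      ≤ (∫⁻ t in dyadicIoc ρ j, f t) + ∫⁻ t in dyadicIoc ρ (j + 1), f t := by
    intro j
    refine le_trans (lintegral_mono_set ?_) (lintegral_union_le f _ _)
    rw [union_comm, dyadicIoc, dyadicIoc, dyadicPair,
      Ioc_union_Ioc_eq_Ioc (div_two_pow_anti hρ (by omega)) (div_two_pow_anti hρ (by omega))]
  refine (Finset.sum_le_sum fun j _ => h1 j).trans ?_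
  rw [Finset.sum_add_distrib, two_mul]
  refine add_le_add ?_ ?_
  · rw [sum_lintegral_dyadicIoc hρ]
    exact lintegral_mono_set (Ioc_subset_Ioc_left (div_two_pow_anti hρ (Nat.le_succ N)))
  · rw [← sum_lintegral_dyadicIoc hρ, Finset.sum_range_succ' _ N]
    exact le_self_add

lemma liminf_add_liminf_le (f g : ℕ → ℝ≥0∞) :
    liminf f atTop + liminf g atTop ≤ liminf (fun k => f k + g k) atTop := by
  simp only [liminf_eq_iSup_iInf_of_nat]
  rw [ENNReal.iSup_add_iSup_of_monotone
    (fun _ _ h => biInf_mono fun _ hi => h.trans hi)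
    (fun _ _ h => biInf_mono fun _ hi => h.trans hi)]
  exact iSup_mono fun k => le_iInf₂ fun i hi => add_le_add (iInf₂_le i hi) (iInf₂_le i hi)

lemma sum_liminf_le {ι : Type*} (s : Finset ι) (f : ι → ℕ → ℝ≥0∞) :
    ∑ i ∈ s, liminf (f i) atTop ≤ liminf (fun k => ∑ i ∈ s, f i k) atTop := by
  classical
  induction s using Finset.induction_on with
  | empty => simp
  | insert i s his ih =>
    simp_rw [Finset.sum_insert his]
    refine (add_le_add le_rfl ih).trans ?_
    exact liminf_add_liminf_le _ _

/-- The fundamental theorem of calculus on a vertical line, where `graphMap` moves with constant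
velocity `e`; no derivative of `γ` enters. -/
lemma enorm_sub_le_lintegral_fderiv {U : 𝔼 → ℝ} (hU : ContDiff ℝ 1 U)
    (y : (Submodule.span ℝ {e})ᗮ) {a b s t : ℝ} (hs : s ∈ Ioc a b) (ht : t ∈ Ioc a b) :
    ‖U (graphMap e γ (y, t)) - U (graphMap e γ (y, s))‖ₑ
      ≤ ∫⁻ r in Ioc a b, ‖fderiv ℝ U (graphMap e γ (y, r)) e‖ₑ := by
  have hd : ∀ r, HasDerivAt (fun r => U (graphMap e γ (y, r)))
      (fderiv ℝ U (graphMap e γ (y, r)) e) r := by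
    intro r
    have h1 : HasDerivAt (fun r => graphMap e γ (y, r)) e r := by
      have := (((hasDerivAt_id r).const_add (γ y)).smul_const e).const_add (y : 𝔼)
      simpa [graphMap] using this
    exact (hU.differentiable one_ne_zero _).hasFDerivAt.comp_hasDerivAt r h1
  have hc : Continuous fun r => fderiv ℝ U (graphMap e γ (y, r)) e := by
    have h1 : Continuous fun r => graphMap e γ (y, r) := by
      change Continuous fun r => (y : 𝔼) + (γ y + r) • e
      fun_prop
    have := hU.continuous_fderiv one_ne_zero
    fun_prop
  rw [← intervalIntegral.integral_eq_sub_of_hasDerivAt (fun r _ => hd r)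
    (hc.intervalIntegrable _ _), ← ofReal_norm,
    intervalIntegral.norm_integral_eq_norm_integral_uIoc,
    ofReal_norm]
  refine (enorm_integral_le_lintegral_enorm _).trans (lintegral_mono_set ?_)
  exact Ioc_subset_Ioc (le_min hs.1.le ht.1.le) (max_le hs.2 ht.2)

/-- A function of bounded variation has summable vertical oscillations above a graph. -/
theorem exists_oscillation_bound (hΩ : IsOpen Ω) (hu : MemBV Ω u) (he : ‖e‖ = 1)
    (hγ : Continuous γ) {D : Set (Submodule.span ℝ {e})ᗮ} (hD : IsCompact D) {ρ : ℝ}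
    (hρ : 0 < ρ) (hsub : ∀ y ∈ D, ∀ t ∈ Ioc 0 ρ, graphMap e γ (y, t) ∈ Ω) :
    ∃ V : ℕ → (Submodule.span ℝ {e})ᗮ → ℝ≥0∞, (∀ j, Measurable (V j)) ∧
      ∑' j, ∫⁻ y in D, V j y ≠ ∞ ∧
      ∀ᵐ y ∂volume.restrict D, ∀ j, ∀ᵐ t ∂volume.restrict (dyadicPair ρ j),
        ∀ᵐ s ∂volume.restrict (dyadicPair ρ j),
          ‖u (graphMap e γ (y, t)) - u (graphMap e γ (y, s))‖ₑ ≤ V j y := by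
  have hui : Integrable (Ω.indicator u) := (integrable_indicator_iff hΩ.measurableSet).2 hu.1
  set U : ℕ → 𝔼 → ℝ := fun k => mollify (bump n k) (Ω.indicator u) with hUdef
  have hUC : ∀ k, ContDiff ℝ 1 (U k) := fun k => contDiff_mollify _ hui.locallyIntegrable
  have hΨ := continuous_graphMap (e := e) hγ
  have hmp := measurePreserving_graphMap he hγ
  have hemb := measurableEmbedding_graphMap he hγ
  set d : ℕ → 𝔼 → ℝ≥0∞ := fun k x => ‖fderiv ℝ (U k) x e‖ₑ with hd
  have hdm : ∀ k, Measurable (d k) := by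
    intro k
    have := (hUC k).continuous_fderiv one_ne_zero
    have h2 : Continuous fun x => fderiv ℝ (U k) x e := by fun_prop
    exact h2.measurable.enorm
  have hdΨ : ∀ k, Measurable fun p => d k (graphMap e γ p) := fun k =>
    (hdm k).comp hΨ.measurable
  set M : ℕ → ℕ → (Submodule.span ℝ {e})ᗮ → ℝ≥0∞ := fun j k y =>
    ∫⁻ t in dyadicPair ρ j, d k (graphMap e γ (y, t)) with hM
  have hMm : ∀ j k, Measurable (M j k) := fun j k => (hdΨ k).lintegral_prod_right'
  -- `V j` is the lower limit of the vertical variations of the mollifications: Fatou bounds its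
  -- integral, and pointwise convergence bounds the oscillation of `u` by it.
  refine ⟨fun j y => liminf (fun k => M j k y) atTop, fun j => Measurable.liminf fun k => hMm j k,
    ?_, ?_⟩
  · refine ne_top_of_le_ne_top (ENNReal.mul_ne_top ENNReal.ofNat_ne_top hu.2.ne :
      2 * totalVariation Ω u ≠ ∞) ?_
    refine ENNReal.tsum_le_of_sum_range_le fun N => ?_
    calc ∑ j ∈ Finset.range N, ∫⁻ y in D, liminf (fun k => M j k y) atTop
        ≤ ∑ j ∈ Finset.range N, liminf (fun k => ∫⁻ y in D, M j k y) atTop :=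
          Finset.sum_le_sum fun j _ => lintegral_liminf_le fun k => hMm j k
      _ ≤ liminf (fun k => ∑ j ∈ Finset.range N, ∫⁻ y in D, M j k y) atTop :=
          sum_liminf_le _ _
      _ ≤ 2 * totalVariation Ω u := by
          -- The first `N` pairs stay at height at least `ρ / 2 ^ (N + 1)`, hence in a compact
          -- subset of `Ω`; the resulting bound does not depend on `N`.
          have hK : IsCompact (graphMap e γ '' (D ×ˢ Icc (ρ / 2 ^ (N + 1)) ρ)) :=
            (hD.prod isCompact_Icc).image hΨ
          have hKΩ : graphMap e γ '' (D ×ˢ Icc (ρ / 2 ^ (N + 1)) ρ) ⊆ Ω := by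
            rintro _ ⟨⟨y, t⟩, ⟨hy, ht⟩, rfl⟩
            exact hsub y hy t ⟨lt_of_lt_of_le (by positivity) ht.1, ht.2⟩
          refine liminf_le_of_frequently_le' (Eventually.frequently ?_)
          filter_upwards [eventually_lintegral_fderiv_mollify_le hΩ hu he hK hKΩ] with k hk
          calc ∑ j ∈ Finset.range N, ∫⁻ y in D, M j k y
              = ∫⁻ y in D, ∑ j ∈ Finset.range N, M j k y :=
                (lintegral_finsetSum _ fun j _ => hMm j k).symm
            _ ≤ ∫⁻ y in D, 2 * ∫⁻ t in Ioc (ρ / 2 ^ (N + 1)) ρ, d k (graphMap e γ (y, t)) :=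
                lintegral_mono fun y => sum_lintegral_dyadicPair_le hρ _ N
            _ = 2 * ∫⁻ y in D, ∫⁻ t in Ioc (ρ / 2 ^ (N + 1)) ρ, d k (graphMap e γ (y, t)) :=
                lintegral_const_mul _ (hdΨ k).lintegral_prod_right'
            _ = 2 * ∫⁻ p in D ×ˢ Ioc (ρ / 2 ^ (N + 1)) ρ, d k (graphMap e γ p) := by
                rw [Measure.volume_eq_prod, ← Measure.prod_restrict,
                  lintegral_prod _ (hdΨ k).aemeasurable]
            _ ≤ 2 * ∫⁻ p in D ×ˢ Icc (ρ / 2 ^ (N + 1)) ρ, d k (graphMap e γ p) := by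
                gcongr
                exact Ioc_subset_Icc_self
            _ ≤ 2 * totalVariation Ω u := by
                rw [hmp.setLIntegral_comp_emb hemb (d k)]
                gcongr
  · have hae : ∀ᵐ y : (Submodule.span ℝ {e})ᗮ, ∀ᵐ t : ℝ,
        Tendsto (fun k => U k (graphMap e γ (y, t))) atTop
          (𝓝 (Ω.indicator u (graphMap e γ (y, t)))) := by
      have := hmp.quasiMeasurePreserving.ae (ae_tendsto_mollify hui)
      rw [Measure.volume_eq_prod] at this
      exact Measure.ae_ae_of_ae_prod this
    filter_upwards [ae_restrict_of_ae hae, ae_restrict_mem hD.isClosed.measurableSet]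
      with y hy hyD j
    have hpair : dyadicPair ρ j ⊆ Ioc 0 ρ :=
      Ioc_subset_Ioc (by positivity) (by simpa using div_two_pow_anti hρ (Nat.zero_le j))
    filter_upwards [ae_restrict_of_ae hy, ae_restrict_mem measurableSet_Ioc] with t ht htj
    filter_upwards [ae_restrict_of_ae hy, ae_restrict_mem measurableSet_Ioc] with s hs hsj
    rw [indicator_of_mem (hsub y hyD t (hpair htj))] at ht
    rw [indicator_of_mem (hsub y hyD s (hpair hsj))] at hs
    rw [← (ht.sub hs).enorm.liminf_eq]
    exact liminf_le_liminf (Eventually.of_forall fun k =>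
      enorm_sub_le_lintegral_fderiv (hUC k) y hsj htj)

end Graph

/-! ### The trace theorem and the boundary term -/

section Trace

variable {n : ℕ}

local notation "𝔼" => EuclideanSpace ℝ (Fin n)

variable {Ω : Set (EuclideanSpace ℝ (Fin n))} {u v : EuclideanSpace ℝ (Fin n) → ℝ}

lemma integrableOn_abs_sub_const (hu : IntegrableOn u Ω) (t : ℝ) (x : 𝔼) (r : ℝ) :
    IntegrableOn (fun y => |u y - t|) (Metric.ball x r ∩ Ω) := by
  have hfin : volume (Metric.ball x r ∩ Ω) ≠ ∞ :=
    ne_top_of_le_ne_top measure_ball_lt_top.ne (measure_mono inter_subset_left)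
  exact ((hu.mono_set inter_subset_right).sub (integrableOn_const hfin)).abs

lemma HasTraceAt.of_abs_sub_le {w : 𝔼 → ℝ} {x : 𝔼} {a b c : ℝ} (hu : IntegrableOn u Ω)
    (hv : IntegrableOn v Ω) (ha : HasTraceAt Ω u x a) (hb : HasTraceAt Ω v x b)
    (h : ∀ y, |w y - c| ≤ |u y - a| + |v y - b|) : HasTraceAt Ω w x c := by
  have hsum := ha.add hb
  rw [add_zero] at hsum
  refine squeeze_zero' ?_ ?_ hsum
  · filter_upwards [self_mem_nhdsWithin] with r (hr : 0 < r)
    exact mul_nonneg (by positivity) (integral_nonneg fun y => abs_nonneg _)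
  · filter_upwards [self_mem_nhdsWithin] with r (hr : 0 < r)
    have h1 := integrableOn_abs_sub_const hu a x r
    have h2 := integrableOn_abs_sub_const hv b x r
    rw [← mul_add, ← integral_add h1 h2]
    refine mul_le_mul_of_nonneg_left ?_ (by positivity)
    exact integral_mono_of_nonneg (Eventually.of_forall fun y => abs_nonneg _) (h1.add h2)
      (Eventually.of_forall h)

lemma HasTraceAt.max {x : 𝔼} {a b : ℝ} (hu : IntegrableOn u Ω) (hv : IntegrableOn v Ω)
    (ha : HasTraceAt Ω u x a) (hb : HasTraceAt Ω v x b) :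
    HasTraceAt Ω (fun y => max (u y) (v y)) x (max a b) :=
  ha.of_abs_sub_le hu hv hb fun _ => (abs_max_sub_max_le_max _ _ _ _).trans
    (max_le_add_of_nonneg (abs_nonneg _) (abs_nonneg _))

lemma HasTraceAt.min {x : 𝔼} {a b : ℝ} (hu : IntegrableOn u Ω) (hv : IntegrableOn v Ω)
    (ha : HasTraceAt Ω u x a) (hb : HasTraceAt Ω v x b) :
    HasTraceAt Ω (fun y => min (u y) (v y)) x (min a b) :=
  ha.of_abs_sub_le hu hv hb fun _ => (abs_min_sub_min_le_max _ _ _ _).trans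
    (max_le_add_of_nonneg (abs_nonneg _) (abs_nonneg _))

variable {e : EuclideanSpace ℝ (Fin n)} {γ : EuclideanSpace ℝ (Fin n) → ℝ} {K : ℝ≥0}
  {x₀ : EuclideanSpace ℝ (Fin n)} {R : ℝ}

lemma finrank_orthogonal_add_one (he : ‖e‖ = 1) :
    Module.finrank ℝ (Submodule.span ℝ {e})ᗮ + 1 = n := by
  have h := (Submodule.span ℝ {e}).finrank_add_finrank_orthogonal
  have he0 : e ≠ 0 := fun h0 => by simp [h0] at he
  rw [finrank_span_singleton he0, finrank_euclideanSpace_fin] at h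
  omega

lemma norm_graphMap_sub_le (he : ‖e‖ = 1) (hγ : LipschitzWith K γ)
    (p q : (Submodule.span ℝ {e})ᗮ × ℝ) :
    ‖graphMap e γ p - graphMap e γ q‖ ≤ (1 + K) * ‖p.1 - q.1‖ + |p.2 - q.2| := by
  have h1 : graphMap e γ p - graphMap e γ q
      = ((p.1 - q.1 : (Submodule.span ℝ {e})ᗮ) : 𝔼) + ((γ p.1 - γ q.1) + (p.2 - q.2)) • e := by
    simp only [graphMap, Submodule.coe_sub]
    module
  have h2 : |γ p.1 - γ q.1| ≤ K * ‖p.1 - q.1‖ := by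
    simpa [Real.dist_eq, dist_eq_norm] using hγ.dist_le_mul (p.1 : 𝔼) q.1
  rw [h1]
  refine (norm_add_le _ _).trans ?_
  rw [norm_smul, he, mul_one, Submodule.coe_norm, Real.norm_eq_abs]
  have h3 := abs_add_le (γ p.1 - γ q.1) (p.2 - q.2)
  rw [← Submodule.coe_norm]
  linarith

lemma graphMap_mem_iff (he : ‖e‖ = 1)
    (hR : ∀ y ∈ Metric.ball x₀ R, (y ∈ Ω ↔ γ (y - inner ℝ e y • e) < inner ℝ e y))
    {p : (Submodule.span ℝ {e})ᗮ × ℝ} (hp : graphMap e γ p ∈ Metric.ball x₀ R) :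
    graphMap e γ p ∈ Ω ↔ 0 < p.2 := by
  rw [hR _ hp, graphMap_sub_inner he, inner_graphMap he]
  exact lt_add_iff_pos_right _

/-- Boundary points lie exactly on the graph: not above it, since `Ω` is open and misses its
frontier, and not below it, since a neighbourhood there would miss `Ω`. -/
lemma graphMap_hproj_zero (hΩ : IsOpen Ω) (he : ‖e‖ = 1) (hγ : Continuous γ)
    (hR : ∀ y ∈ Metric.ball x₀ R, (y ∈ Ω ↔ γ (y - inner ℝ e y • e) < inner ℝ e y)) {x : 𝔼}
    (hx : x ∈ frontier Ω) (hxR : x ∈ Metric.ball x₀ R) : graphMap e γ (hproj e x, 0) = x := by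
  have hxΩ : x ∉ Ω := fun h => by
    rw [hΩ.frontier_eq] at hx; exact hx.2 h
  have h1 : inner ℝ e x ≤ γ (x - inner ℝ e x • e) := by
    rw [hR x hxR] at hxΩ; exact not_lt.1 hxΩ
  have h2 : γ (x - inner ℝ e x • e) ≤ inner ℝ e x := by
    by_contra! h
    have hopen : IsOpen {y : 𝔼 | inner ℝ e y < γ (y - inner ℝ e y • e)} :=
      isOpen_lt (by fun_prop) (by fun_prop)
    obtain ⟨y, hy, hyΩ⟩ := mem_closure_iff_nhds.1 (frontier_subset_closure hx) _
      (inter_mem (hopen.mem_nhds h) (Metric.isOpen_ball.mem_nhds hxR))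
    exact lt_asymm hy.1 ((hR y hy.2).1 hyΩ)
  have h3 : γ (hproj e x) = inner ℝ e x := by rw [coe_hproj he]; exact le_antisymm h2 h1
  conv_rhs => rw [← graphMap_hproj (γ := γ) he x]
  rw [h3, sub_self]

/-- `Ω` fills a fixed proportion of each small ball at a boundary point, so two constants cannot
both be limits in mean. This makes `trace`, defined by choice, computable from any known trace
value. -/
lemma HasTraceAt.unique (hL : HasLipschitzBoundary Ω) (hΩ : IsOpen Ω) (hu : IntegrableOn u Ω)
    {x : 𝔼} (hx : x ∈ frontier Ω) {s t : ℝ} (hs : HasTraceAt Ω u x s)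
    (ht : HasTraceAt Ω u x t) : s = t := by
  obtain ⟨e, he, K, γ, hγ, hev⟩ := hL x hx
  obtain ⟨R, hR0, hR⟩ := Metric.eventually_nhds_iff_ball.1 hev
  have hxe := graphMap_hproj_zero hΩ he hγ.continuous hR hx (Metric.mem_ball_self hR0)
  set y₀ := hproj e x
  -- Chosen so that `(1 + K) a r + a r = r`: the cylinder of radius and height `a r` then maps into
  -- the ball of radius `r`.
  set a : ℝ := 1 / (2 + K) with ha
  have ha0 : 0 < a := by positivity
  set c : ℝ := volume.real (Metric.ball (0 : (Submodule.span ℝ {e})ᗮ) 1) with hc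
  have hc0 : 0 < c := ENNReal.toReal_pos (Metric.measure_ball_pos volume _ one_pos).ne'
    measure_ball_lt_top.ne
  have hn : Module.finrank ℝ (Submodule.span ℝ {e})ᗮ + 1 = n := finrank_orthogonal_add_one he
  have hvol : ∀ r : ℝ, 0 < r → r < R → c * (a * r) ^ n ≤ volume.real (Metric.ball x r ∩ Ω) := by
    intro r hr hrR
    have har : 0 < a * r := by positivity
    have hsub : Metric.ball y₀ (a * r) ×ˢ Ioo 0 (a * r)
        ⊆ graphMap e γ ⁻¹' (Metric.ball x r ∩ Ω) := by
      rintro ⟨y, t'⟩ ⟨hy, ht'⟩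
      simp only [mem_ball_iff_norm] at hy
      have hb : graphMap e γ (y, t') ∈ Metric.ball x r := by
        have h1 := norm_graphMap_sub_le he hγ (y, t') (y₀, 0)
        rw [hxe] at h1
        rw [mem_ball_iff_norm]
        refine h1.trans_lt ?_
        simp only [sub_zero, abs_of_pos ht'.1]
        have h2 : (1 + K : ℝ) * ‖y - y₀‖ ≤ (1 + K) * (a * r) := by gcongr
        have h3 : (1 + K : ℝ) * (a * r) + a * r = r := by rw [ha]; field_simp; ring
        linarith [ht'.2]
      exact ⟨hb, (graphMap_mem_iff he hR (Metric.ball_subset_ball hrR.le hb)).2 ht'.1⟩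
    have hfin : volume (Metric.ball x r ∩ Ω) ≠ ∞ :=
      ne_top_of_le_ne_top measure_ball_lt_top.ne (measure_mono inter_subset_left)
    have h1 : volume (Metric.ball y₀ (a * r) ×ˢ Ioo 0 (a * r))
        ≤ volume (Metric.ball x r ∩ Ω) := by
      rw [← (measurePreserving_graphMap he hγ.continuous).measure_preimage
        (Metric.isOpen_ball.inter hΩ).measurableSet.nullMeasurableSet]
      exact measure_mono hsub
    have h2 := ENNReal.toReal_mono hfin h1
    refine le_trans (le_of_eq ?_) h2
    rw [Measure.volume_eq_prod, Measure.prod_prod, ENNReal.toReal_mul, Real.volume_Ioo, sub_zero,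
      ENNReal.toReal_ofReal har.le]
    rw [Measure.addHaar_ball_of_pos _ _ har, ENNReal.toReal_mul,
      ENNReal.toReal_ofReal (by positivity),
      ← Measure.real, ← hc]
    conv_lhs => rw [← hn]
    ring
  have hlim := hs.add ht
  rw [add_zero] at hlim
  have hle : |s - t| * (c * a ^ n) ≤ 0 := by
    refine ge_of_tendsto hlim ?_
    filter_upwards [self_mem_nhdsWithin, nhdsWithin_le_nhds (Iio_mem_nhds hR0)]
      with r (hr : 0 < r) (hrR : r < R)
    have h1 := integrableOn_abs_sub_const hu s x r
    have h2 := integrableOn_abs_sub_const hu t x r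
    have hfin : volume (Metric.ball x r ∩ Ω) ≠ ∞ :=
      ne_top_of_le_ne_top measure_ball_lt_top.ne (measure_mono inter_subset_left)
    rw [← mul_add, ← integral_add h1 h2]
    have h3 : |s - t| * volume.real (Metric.ball x r ∩ Ω)
        ≤ ∫ y in Metric.ball x r ∩ Ω, (|u y - s| + |u y - t|) := by
      rw [mul_comm, ← smul_eq_mul, ← setIntegral_const]
      refine integral_mono (integrableOn_const hfin) (h1.add h2) fun y => ?_
      simp only
      rw [abs_sub_comm (u y) s]
      exact abs_sub_le _ _ _
    have hrn : 0 < r ^ n := by positivity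
    rw [inv_mul_eq_div, le_div_iff₀ hrn]
    refine le_trans ?_ h3
    calc |s - t| * (c * a ^ n) * r ^ n = |s - t| * (c * (a * r) ^ n) := by ring
      _ ≤ _ := mul_le_mul_of_nonneg_left (hvol r hr hrR) (abs_nonneg _)
  have hpos : 0 < c * a ^ n := by positivity
  have : |s - t| = 0 := le_antisymm (nonpos_of_mul_nonpos_left hle hpos) (abs_nonneg _)
  exact sub_eq_zero.1 (abs_eq_zero.1 this)

lemma HasTraceAt.trace_eq (hL : HasLipschitzBoundary Ω) (hΩ : IsOpen Ω) (hu : IntegrableOn u Ω)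
    {x : 𝔼} (hx : x ∈ frontier Ω) {t : ℝ} (ht : HasTraceAt Ω u x t) : trace Ω u x = t := by
  have h : ∃ t, HasTraceAt Ω u x t := ⟨t, ht⟩
  rw [trace, dif_pos h]
  exact h.choose_spec.unique hL hΩ hu hx ht

lemma euclideanHausdorffMeasure_image_le {X Y : Type*} [MetricSpace X] [MeasurableSpace X]
    [BorelSpace X] [MetricSpace Y] [MeasurableSpace Y] [BorelSpace Y] {f : X → Y} {C : ℝ≥0}
    (hf : LipschitzWith C f) (d : ℕ) (s : Set X) :
    μHE[d] (f '' s) ≤ (C : ℝ≥0∞) ^ d * μHE[d] s := by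
  simp_rw [Measure.euclideanHausdorffMeasure_def, Measure.smul_apply]
  have h := hf.hausdorffMeasure_image_le (d := d) d.cast_nonneg s
  rw [ENNReal.rpow_natCast] at h
  refine (smul_le_smul_of_nonneg_left h zero_le).trans (le_of_eq ?_)
  rw [ENNReal.smul_def, ENNReal.smul_def, smul_eq_mul, smul_eq_mul]
  ring

/-- Local form of the trace theorem, in a boundary chart. -/
lemma exists_nhdsWithin_trace (hL : HasLipschitzBoundary Ω) (hΩ : IsOpen Ω) (hu : MemBV Ω u)
    (hx₀ : x₀ ∈ frontier Ω) :
    ∃ S ∈ 𝓝[frontier Ω] x₀, (∀ᵐ x ∂(μHE[n - 1] : Measure 𝔼).restrict S, ∃ t, HasTraceAt Ω u x t)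
      ∧ IntegrableOn (trace Ω u) S μHE[n - 1] := by
  obtain ⟨e, he, K, γ, hγ, hev⟩ := hL x₀ hx₀
  obtain ⟨R, hR0, hR⟩ := Metric.eventually_nhds_iff_ball.1 hev
  have hγc := hγ.continuous
  have hn : Module.finrank ℝ (Submodule.span ℝ {e})ᗮ + 1 = n := finrank_orthogonal_add_one he
  set y₀ := hproj e x₀ with hy₀
  have hx₀e := graphMap_hproj_zero hΩ he hγc hR hx₀ (Metric.mem_ball_self hR0)
  -- Here `(1 + K) ρ + ρ = R / 2`, so the closed cylinder stays inside the chart ball.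
  set ρ : ℝ := R / (2 * (2 + K)) with hρdef
  have hρ : 0 < ρ := by positivity
  have hball : ∀ y ∈ Metric.closedBall y₀ ρ, ∀ t ∈ Icc 0 ρ,
      graphMap e γ (y, t) ∈ Metric.ball x₀ R := by
    intro y hy t ht
    have h1 := norm_graphMap_sub_le he hγ (y, t) (y₀, 0)
    rw [hx₀e] at h1
    rw [mem_ball_iff_norm]
    refine h1.trans_lt ?_
    rw [mem_closedBall_iff_norm] at hy
    simp only [sub_zero, abs_of_nonneg ht.1]
    have h2 : (1 + K : ℝ) * ‖y - y₀‖ ≤ (1 + K) * ρ := by gcongr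
    have h3 : (1 + K : ℝ) * ρ + ρ = R / 2 := by rw [hρdef]; field_simp; ring
    linarith [ht.2]
  set D := Metric.closedBall y₀ ρ with hD
  have hDc : IsCompact D := isCompact_closedBall _ _
  have hDΩ : ∀ y ∈ D, ∀ t ∈ Ioc 0 ρ, graphMap e γ (y, t) ∈ Ω := fun y hy t ht =>
    (graphMap_mem_iff he hR (hball y hy t ⟨ht.1.le, ht.2⟩)).2 ht.1
  have hmp := measurePreserving_graphMap he hγc
  have hemb := measurableEmbedding_graphMap he hγc
  set w : (Submodule.span ℝ {e})ᗮ × ℝ → ℝ := fun p => u (graphMap e γ p) with hw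
  have hwi : IntegrableOn w (D ×ˢ Ioc 0 ρ) :=
    ((hmp.integrableOn_comp_preimage hemb).2 hu.1).mono_set fun p hp => hDΩ p.1 hp.1 p.2 hp.2
  obtain ⟨V, hVm, hVs, hV⟩ := exists_oscillation_bound hΩ hu he hγc hDc hρ hDΩ
  obtain ⟨τ, hτm, hτi, hτ⟩ := exists_trace_of_oscillation hρ hDc.isClosed.measurableSet hwi hVm
    hVs hV
  set Γ : (Submodule.span ℝ {e})ᗮ → 𝔼 := fun y => graphMap e γ (y, 0) with hΓ
  set D' := Metric.ball y₀ ρ with hD'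
  have hD'D : D' ⊆ interior D := Metric.ball_subset_interior_closedBall
  have htrace : ∀ᵐ y ∂volume.restrict D', HasTraceAt Ω u (Γ y) (τ y) := by
    filter_upwards [ae_restrict_of_ae_restrict_of_subset hD'D hτ,
      ae_restrict_mem Metric.isOpen_ball.measurableSet] with y hy hyD
    -- A point of `B_r(Γ y) ∩ Ω` has base point within `r` of `y` and height at most `r + K r`, so
    -- the ball sits in a cylinder of aspect `L = 1 + K`.
    have hLim := hy (1 + K) (by positivity)
    rw [hn] at hLim
    obtain ⟨δ, hδ, hδD⟩ := Metric.isOpen_ball.mem_nhds hyD |> Metric.mem_nhds_iff.1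
    have hΓR : Γ y ∈ Metric.ball x₀ R :=
      hball y (Metric.ball_subset_closedBall hyD) 0 ⟨le_rfl, hρ.le⟩
    obtain ⟨δ', hδ', hδR⟩ := Metric.isOpen_ball.mem_nhds hΓR |> Metric.mem_nhds_iff.1
    refine squeeze_zero' ?_ ?_ hLim
    · filter_upwards [self_mem_nhdsWithin] with r (hr : 0 < r)
      exact mul_nonneg (by positivity) (integral_nonneg fun y => abs_nonneg _)
    · have hKpos : (0 : ℝ) < 1 + K := by positivity
      filter_upwards [self_mem_nhdsWithin, nhdsWithin_le_nhds (Iio_mem_nhds hδ),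
        nhdsWithin_le_nhds (Iio_mem_nhds hδ'),
        nhdsWithin_le_nhds (Iio_mem_nhds (div_pos hρ hKpos))]
        with r (hr : 0 < r) (hrδ : r < δ) (hrδ' : r < δ') (hrρ : r < ρ / (1 + K))
      rw [lt_div_iff₀ hKpos, mul_comm] at hrρ
      refine mul_le_mul_of_nonneg_left ?_ (by positivity)
      rw [← hmp.setIntegral_preimage_emb hemb (fun z => |u z - τ y|)]
      have hsub : graphMap e γ ⁻¹' (Metric.ball (Γ y) r ∩ Ω)
          ⊆ Metric.closedBall y r ×ˢ Ioc 0 ((1 + K) * r) := by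
        rintro ⟨z, t⟩ ⟨hzb, hzΩ⟩
        have ht0 : 0 < t := (graphMap_mem_iff he hR
          (hδR (Metric.ball_subset_ball hrδ'.le hzb))).1 hzΩ
        rw [mem_ball_iff_norm] at hzb
        have h1 : ‖z - y‖ ≤ r := by
          have := norm_hproj_sub_le (e := e) (graphMap e γ (z, t)) (Γ y)
          rw [hΓ, hproj_graphMap he, hproj_graphMap he] at this
          exact this.trans hzb.le
        have h2 : (γ z + t) - γ y ≤ r := by
          have h3 := abs_real_inner_le_norm e (graphMap e γ (z, t) - Γ y)
          rw [he, one_mul, inner_sub_right, hΓ, inner_graphMap he, inner_graphMap he] at h3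
          simp only [add_zero] at h3
          exact (le_abs_self _).trans (h3.trans hzb.le)
        have h4 : |γ z - γ y| ≤ K * ‖z - y‖ := by
          simpa [Real.dist_eq, dist_eq_norm] using hγ.dist_le_mul (z : 𝔼) y
        have h5 : K * ‖z - y‖ ≤ K * r := by gcongr
        refine ⟨by rwa [mem_closedBall_iff_norm], ht0, ?_⟩
        have h6 := neg_le_of_abs_le h4
        simp only
        linarith
      have hcylD : Metric.closedBall y r ×ˢ Ioc 0 ((1 + K) * r) ⊆ D ×ˢ Ioc 0 ρ :=
        prod_mono ((Metric.closedBall_subset_ball hrδ).trans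
          (hδD.trans Metric.ball_subset_closedBall)) (Ioc_subset_Ioc_right hrρ.le)
      have hfin : volume (Metric.closedBall y r ×ˢ Ioc (0 : ℝ) ((1 + K) * r)) ≠ ∞ := by
        rw [Measure.volume_eq_prod, Measure.prod_prod]
        exact ENNReal.mul_ne_top measure_closedBall_lt_top.ne (by simp)
      refine setIntegral_mono_set ?_ (Eventually.of_forall fun p => abs_nonneg _)
        hsub.eventuallyLE
      exact ((hwi.mono_set hcylD).sub (integrableOn_const hfin)).abs
  have hΓemb : MeasurableEmbedding Γ := by
    refine Continuous.measurableEmbedding ?_ fun a b hab => ?_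
    · exact (continuous_graphMap hγc).comp (by fun_prop)
    · exact congrArg Prod.fst (graphMap_injective he hab)
  have hΓlip : LipschitzWith (1 + K) Γ := by
    refine LipschitzWith.of_dist_le_mul fun a b => ?_
    rw [dist_eq_norm, dist_eq_norm]
    simpa using norm_graphMap_sub_le he hγ (a, 0) (b, 0)
  set S := frontier Ω ∩ Metric.ball x₀ (min ρ R) with hS
  have hSm : MeasurableSet S :=
    isClosed_frontier.measurableSet.inter Metric.isOpen_ball.measurableSet
  have hSΓ : ∀ x ∈ S, hproj e x ∈ D' ∧ Γ (hproj e x) = x := by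
    intro x hx
    refine ⟨?_, graphMap_hproj_zero hΩ he hγc hR hx.1
      (Metric.ball_subset_ball (min_le_right _ _) hx.2)⟩
    rw [hD', mem_ball_iff_norm]
    exact (norm_hproj_sub_le x x₀).trans_lt
      (mem_ball_iff_norm.1 (Metric.ball_subset_ball (min_le_left _ _) hx.2))
  set c : ℝ≥0∞ := ((1 + K : ℝ≥0) : ℝ≥0∞) ^ (n - 1) with hc
  have hctop : c ≠ ∞ := ENNReal.pow_ne_top ENNReal.coe_ne_top
  -- `S` is covered by the image of `D'` under the `(1 + K)`-Lipschitz map `Γ`, and on the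
  -- hyperplane `μHE[n - 1]` is Lebesgue measure. This domination carries both null sets and
  -- integrability to the boundary.
  have hμ : (μHE[n - 1] : Measure 𝔼).restrict S ≤ c • (volume.restrict D').map Γ := by
    refine Measure.le_iff.2 fun A hA => ?_
    rw [Measure.restrict_apply hA, Measure.smul_apply, hΓemb.map_apply,
      Measure.restrict_apply (hΓemb.measurable hA), smul_eq_mul]
    have hsub : A ∩ S ⊆ Γ '' (Γ ⁻¹' A ∩ D') := fun x hx =>
      ⟨hproj e x, ⟨by rw [mem_preimage, (hSΓ x hx.2).2]; exact hx.1, (hSΓ x hx.2).1⟩,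
        (hSΓ x hx.2).2⟩
    refine (measure_mono hsub).trans ((euclideanHausdorffMeasure_image_le hΓlip _ _).trans ?_)
    rw [show n - 1 = Module.finrank ℝ (Submodule.span ℝ {e})ᗮ by omega,
      InnerProductSpace.euclideanHausdorffMeasure_eq_volume, hc,
      show n - 1 = Module.finrank ℝ (Submodule.span ℝ {e})ᗮ by omega]
  have hac : (μHE[n - 1] : Measure 𝔼).restrict S ≪ (volume.restrict D').map Γ :=
    (Measure.absolutelyContinuous_of_le hμ).trans Measure.smul_absolutelyContinuous
  have hae : ∀ᵐ x ∂(μHE[n - 1] : Measure 𝔼).restrict S, HasTraceAt Ω u x (τ (hproj e x)) := by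
    refine hac.ae_le (hΓemb.ae_map_iff.2 ?_)
    filter_upwards [htrace] with y hy
    simpa only [hΓ, hproj_graphMap he] using hy
  refine ⟨S, inter_mem self_mem_nhdsWithin (nhdsWithin_le_nhds
    (Metric.ball_mem_nhds _ (lt_min hρ hR0))), hae.mono fun x hx => ⟨_, hx⟩, ?_⟩
  have hint : Integrable (fun x => τ (hproj e x)) ((volume.restrict D').map Γ) := by
    rw [hΓemb.integrable_map_iff]
    refine (hτi.mono_set Metric.ball_subset_closedBall).congr (Eventually.of_forall fun y => ?_)
    simp only [Function.comp, hΓ, hproj_graphMap he]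
  refine ((hint.smul_measure hctop).mono_measure hμ).congr ?_
  filter_upwards [hae, ae_restrict_mem hSm] with x hx hxS
  exact (hx.trace_eq hL hΩ hu.1 hxS.1).symm

/-- The trace of a function of bounded variation on a bounded Lipschitz domain exists almost
everywhere on the boundary and is integrable. -/
theorem ae_exists_hasTraceAt_and_integrableOn_trace (hL : HasLipschitzBoundary Ω) (hΩ : IsOpen Ω)
    (hΩb : Bornology.IsBounded Ω) (hu : MemBV Ω u) :
    (∀ᵐ x ∂(μHE[n - 1] : Measure 𝔼).restrict (frontier Ω), ∃ t, HasTraceAt Ω u x t)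
      ∧ IntegrableOn (trace Ω u) (frontier Ω) μHE[n - 1] := by
  have hK : IsCompact (frontier Ω) := Metric.isCompact_of_isClosed_isBounded isClosed_frontier
    (hΩb.closure.subset frontier_subset_closure)
  refine hK.induction_on (p := fun S =>
    (∀ᵐ x ∂(μHE[n - 1] : Measure 𝔼).restrict S, ∃ t, HasTraceAt Ω u x t)
      ∧ IntegrableOn (trace Ω u) S μHE[n - 1]) (by simp) ?_ ?_ ?_
  · exact fun s t hst h => ⟨ae_restrict_of_ae_restrict_of_subset hst h.1, h.2.mono_set hst⟩
  · exact fun s t hs ht => ⟨(ae_restrict_union_iff _ _ _).2 ⟨hs.1, ht.1⟩, hs.2.union ht.2⟩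
  · exact fun x hx => exists_nhdsWithin_trace hL hΩ hu hx

/-- Almost everywhere the traces of max and min are the max and min of the two traces, so the
absolute values have the same sum; integrability allows the integrals to be added. -/
lemma integral_abs_trace_max_add_min (hL : HasLipschitzBoundary Ω) (hΩ : IsOpen Ω)
    (hΩb : Bornology.IsBounded Ω) (hu : MemBV Ω u) (hv : MemBV Ω v)
    (hmax : MemBV Ω fun x => max (u x) (v x)) (hmin : MemBV Ω fun x => min (u x) (v x)) :
    (∫ x in frontier Ω, |trace Ω (fun x => max (u x) (v x)) x| ∂μHE[n - 1])
      + (∫ x in frontier Ω, |trace Ω (fun x => min (u x) (v x)) x| ∂μHE[n - 1])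
    = (∫ x in frontier Ω, |trace Ω u x| ∂μHE[n - 1])
      + ∫ x in frontier Ω, |trace Ω v x| ∂μHE[n - 1] := by
  obtain ⟨hue, hui⟩ := ae_exists_hasTraceAt_and_integrableOn_trace hL hΩ hΩb hu
  obtain ⟨hve, hvi⟩ := ae_exists_hasTraceAt_and_integrableOn_trace hL hΩ hΩb hv
  have hmaxi := (ae_exists_hasTraceAt_and_integrableOn_trace hL hΩ hΩb hmax).2
  have hmini := (ae_exists_hasTraceAt_and_integrableOn_trace hL hΩ hΩb hmin).2
  rw [← integral_add hmaxi.abs hmini.abs, ← integral_add hui.abs hvi.abs]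
  refine integral_congr_ae ?_
  filter_upwards [hue, hve, ae_restrict_mem isClosed_frontier.measurableSet]
    with x ⟨a, ha⟩ ⟨b, hb⟩ hx
  rw [(ha.max hu.1 hv.1 hb).trace_eq hL hΩ hmax.1 hx,
    (ha.min hu.1 hv.1 hb).trace_eq hL hΩ hmin.1 hx,
    ha.trace_eq hL hΩ hu.1 hx, hb.trace_eq hL hΩ hv.1 hx]
  rcases le_total a b with h | h
  · rw [max_eq_right h, min_eq_left h, add_comm]
  · rw [max_eq_left h, min_eq_right h]

lemma integrable_comp_of_growth {q : ℝ} (hq : 1 ≤ q) {G : 𝔼 → ℝ → ℝ} {C₁ C₂ : 𝔼 → ℝ}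
    (hG : AEStronglyMeasurable (fun x => G x (u x)) (volume.restrict Ω))
    (hC₁ : MemLp C₁ ∞ (volume.restrict Ω)) (hC₂ : IntegrableOn C₂ Ω)
    (hgrowth : ∀ᵐ x ∂(volume.restrict Ω), ∀ s : ℝ, |G x s| ≤ C₁ x * |s| ^ q + C₂ x)
    (hu : MemLp u (ENNReal.ofReal q) (volume.restrict Ω)) :
    IntegrableOn (fun x => G x (u x)) Ω := by
  have hq0 : 0 < q := lt_of_lt_of_le one_pos hq
  have hpow : Integrable (fun x => |u x| ^ q) (volume.restrict Ω) := by
    have := hu.integrable_norm_rpow (by simpa using hq0) ENNReal.ofReal_ne_top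
    simpa [ENNReal.toReal_ofReal hq0.le] using this
  have hprod : Integrable (fun x => C₁ x * |u x| ^ q) (volume.restrict Ω) := by
    have := (memLp_one_iff_integrable.2 hpow).mul (r := 1) hC₁
    exact memLp_one_iff_integrable.1 this
  refine (hprod.add hC₂).mono' hG ?_
  filter_upwards [hgrowth] with x hx
  exact hx (u x)

end Trace

end BVArea

/-- Comparison principle for minimizers. The assumptions `hGp`, `hGm` say that the integrands
`x ↦ G(x, v(x))` are measurable for the `v` under consideration; they hold for instance for all
Carathéodory functions `G`. -/
theorem mainTheorem9 {n : ℕ} (hn : 1 ≤ n)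
    (Ω : Set (EuclideanSpace ℝ (Fin n))) (hΩ : IsOpen Ω) (hΩb : Bornology.IsBounded Ω)
    (hΩL : BVArea.HasLipschitzBoundary Ω)
    (q : ℝ) (hq : 1 ≤ q)
    (Gp Gm : EuclideanSpace ℝ (Fin n) → ℝ → ℝ)
    (hGp : ∀ v ∈ BVArea.LqBV q Ω,
      AEStronglyMeasurable (fun x => Gp x (v x)) (volume.restrict Ω))
    (hGm : ∀ v ∈ BVArea.LqBV q Ω,
      AEStronglyMeasurable (fun x => Gm x (v x)) (volume.restrict Ω))
    (C₁ C₂ : EuclideanSpace ℝ (Fin n) → ℝ)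
    (hC₁ : MemLp C₁ ∞ (volume.restrict Ω)) (hC₂ : IntegrableOn C₂ Ω)
    (hGp_growth : ∀ᵐ x ∂(volume.restrict Ω), ∀ s : ℝ, |Gp x s| ≤ C₁ x * |s| ^ q + C₂ x)
    (hGm_growth : ∀ᵐ x ∂(volume.restrict Ω), ∀ s : ℝ, |Gm x s| ≤ C₁ x * |s| ^ q + C₂ x)
    (Kp Km : Set (EuclideanSpace ℝ (Fin n) → ℝ))
    (hKp : Kp ⊆ BVArea.LqBV q Ω) (hKm : Km ⊆ BVArea.LqBV q Ω)
    (up um : EuclideanSpace ℝ (Fin n) → ℝ)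
    (hup : BVArea.IsMinimizer (BVArea.energy Ω Gp) Kp up)
    (hum : BVArea.IsMinimizer (BVArea.energy Ω Gm) Km um)
    (hmin : (fun x => min (up x) (um x)) ∈ Km)
    (hmax : (fun x => max (up x) (um x)) ∈ Kp) :
    0 ≤ BVArea.energyGap Ω Gp Gm (fun x => max (up x) (um x)) -
      BVArea.energyGap Ω Gp Gm up := by
  have hupB := hKp hup.1
  have humB := hKm hum.1
  have hmaxB := hKp hmax
  have hminB := hKm hmin
  have hIp : ∀ v ∈ BVArea.LqBV q Ω, IntegrableOn (fun x => Gp x (v x)) Ω := fun v hv =>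
    BVArea.integrable_comp_of_growth hq (hGp v hv) hC₁ hC₂ hGp_growth hv.1
  have hIm : ∀ v ∈ BVArea.LqBV q Ω, IntegrableOn (fun x => Gm x (v x)) Ω := fun v hv =>
    BVArea.integrable_comp_of_growth hq (hGm v hv) hC₁ hC₂ hGm_growth hv.1
  have harea := BVArea.area_max_add_area_min_le hΩ hΩb.measure_lt_top hupB.2 humB.2
  have htrace := BVArea.integral_abs_trace_max_add_min hΩL hΩ hΩb hupB.2 humB.2 hmaxB.2 hminB.2
  -- The exchanged competitors: the maximum for `ℱ₊`, the minimum for `ℱ₋`.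
  have h1 := hup.2 _ hmax
  have h2 := hum.2 _ hmin
  simp only [BVArea.energy] at h1 h2
  have hGm_eq : (∫ x in Ω, Gm x (max (up x) (um x))) + (∫ x in Ω, Gm x (min (up x) (um x)))
      = (∫ x in Ω, Gm x (up x)) + ∫ x in Ω, Gm x (um x) := by
    rw [← integral_add (hIm _ hmaxB) (hIm _ hminB), ← integral_add (hIm _ hupB) (hIm _ humB)]
    congr 1
    ext x
    rcases le_total (up x) (um x) with h | h
    · rw [max_eq_right h, min_eq_left h, add_comm]
    · rw [max_eq_left h, min_eq_right h]
  simp only [BVArea.energyGap]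
  rw [integral_sub (hIp _ hmaxB) (hIm _ hmaxB), integral_sub (hIp _ hupB) (hIm _ hupB)]
  linarith
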